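/- Consider the interconnection $\dot x_1=f_1(x_1,x_2,u_1)$, $\dot x_2=f_2(x_1,x_2,u_2)$ with $x_i\in\mathbb R^{n_i}$, $u_i\in\mathbb R^{m_i}$, $f_i$ of class $C^1$ and $f_i(0,0,0)=0$, written $\dot x=f(x,u)$ with $x=(x_1,x_2)\in\mathbb R^{n}$, $n=n_1+n_2$, and $u=(u_1,u_2)\in\mathbb R^{m}$, $m=m_1+m_2$. A function $[0,\infty)\to[0,\infty)$ is of class $\mathcal K_\infty$ if it is continuous, strictly increasing, unbounded and zero at $0$. Assume that for $\{i,j\}=\{1,2\}$ there is an ISS-Lyapunov function $V_i$ for the $i$-th subsystem, i.e. a locally Lipschitz function $V_i:\mathbb R^{n_i}\to[0,\infty)$ with $\underline\alpha_i(|x_i|)\le V_i(x_i)\le\overline\alpha_i(|x_i|)$ for all $x_i$ and some $\underline\alpha_i,\overline\alpha_i\in\mathcal K_\infty$, and functions $\gamma_{ij},\gamma_i,\alpha_i\in\mathcal K_\infty$ such that, for almost all $(x_i,x_j,u_i)\in\mathbb R^{n_i}\times\mathbb R^{n_j}\times\mathbb R^{m_i}$, $$V_i(x_i)\ge\max\{\gamma_{ij}(V_j(x_j)),\gamma_i(|u_i|)\}\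 \Longrightarrow\ \nabla V_i(x_i)\cdot f_i\le-\alpha_i(|x_i|),$$ where $f_i$ is evaluated at $(x_1,x_2,u_i)$. Let $\ell\ge1$ and $0\le\underline M_1<\overline M_1\le\underline M_2<\overline M_2\le\dots\le\underline M_\ell<\overline M_\ell\le\infty$ be such that, for every $k\in\{1,\dots,\ell\}$, $\gamma_{12}(\gamma_{21}(s))<s$ for all $s\in(\underline M_k,\overline M_k)$, and $\gamma_{12}(\gamma_{21}(\underline M_k))=\underline M_k$, $\gamma_{12}(\gamma_{21}(\overline M_k))=\overline M_k$ (with the convention that functions of class $\mathcal K_\infty$ map $\infty$ to $\infty$). Put $$A_k=\{x: V_1(x_1)\le\max\{\underline M_k,\gamma_{12}(\underline M_k)\},\ V_2(x_2)\le\max\{\gamma_{21}(\underline M_k),\gamma_{21}(\gamma_{21}(\underline M_k))\}\},$$ $$B_k=\{x: V_1(x_1)\le\overline M_k,\ V_2(x_2)\le\gamma_{21}(\overline M_k)\}.$$ Then there is $\gamma\in\mathcal K_\infty$ such that the following holds. (i) If $\overline M_\ell=\infty$, then for every $k\in\{1,\dots,\ell\}$ and every measurable, essentially bounded input $u:[0,\infty)\to\mathbb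 R^m$, with $|u|_\infty$ the essential supremum of $|u(t)|$, for Lebesgue-almost every $x_0\in B_k$ the (Carathéodory) solution with $x(0)=x_0$ exists for all $t\ge0$ and converges, as $t\to\infty$, to the closed neighbourhood of $A_k$ of radius $\gamma(|u|_\infty)$. (ii) If $\overline M_\ell<\infty$, then there is $\delta>0$ such that the same holds for every $k\in\{1,\dots,\ell\}$ and every measurable, essentially bounded input $u$ with $|u|_\infty\le\delta$. -/

import Mathlib

open MeasureTheory Set Filter Topology

namespace FeedbackISS

/-- `ℝⁿ` with the Euclidean norm. -/
abbrev E (n : ℕ) : Type := EuclideanSpace ℝ (Fin n)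

/-- `ℝ^(p+q)` written as pairs `(x₁, x₂)` with `x₁ ∈ ℝ^p`, `x₂ ∈ ℝ^q`; the norm is the
Euclidean one, `|x|² = |x₁|² + |x₂|²`, and `volume` is Lebesgue measure. -/
abbrev Pair (p q : ℕ) : Type := WithLp 2 (E p × E q)

/-- Class `K∞`: continuous, strictly increasing, unbounded functions on `[0,∞)` vanishing at `0`.
Only the values on `[0,∞)` matter. -/
structure IsKInfty (γ : ℝ → ℝ) : Prop where
  continuousOn : ContinuousOn γ (Ici 0)
  strictMonoOn : StrictMonoOn γ (Ici 0)
  map_zero : γ 0 = 0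
  tendsto_atTop : Tendsto γ atTop atTop

/-- Storage functions: locally Lipschitz, nonnegative, with `K∞` bounds of `|x|` on both sides. -/
structure IsStorage {n : ℕ} (V : E n → ℝ) : Prop where
  locallyLipschitz : LocallyLipschitz V
  nonneg : ∀ x, 0 ≤ V x
  bounds : ∃ αlo αhi : ℝ → ℝ, IsKInfty αlo ∧ IsKInfty αhi ∧
    ∀ x, αlo ‖x‖ ≤ V x ∧ V x ≤ αhi ‖x‖

/-- `V` is an ISS-Lyapunov function for `ẏ = g(y, z, v)` where `y` is the own state, `z` the state
of the other subsystem (with storage function `W`) and `v` the external input; `γint` is the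
interconnecting gain, `γext` the external gain and `α` the decay rate. The derivative
`∇V(y) · g(y, z, v)` exists for almost every `y` because `V` is locally Lipschitz. -/
structure IsISSLyapunov {n n' m : ℕ} (g : E n → E n' → E m → E n) (V : E n → ℝ) (W : E n' → ℝ)
    (γint γext α : ℝ → ℝ) : Prop where
  storage : IsStorage V
  gain_int : IsKInfty γint
  gain_ext : IsKInfty γext
  rate : IsKInfty α
  decay : ∀ᵐ p : E n × E n' × E m,
    max (γint (W p.2.1)) (γext ‖p.2.2‖) ≤ V p.1 →
      fderiv ℝ V p.1 (g p.1 p.2.1 p.2.2) ≤ -α ‖p.1‖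

/-- The local small-gain condition: for `1 ≤ k ≤ ℓ` there are endpoints `Mlo k ∈ [0,∞)` and
`Mhi k ∈ (Mlo k, ∞]` which are fixed points of `γ₁₂ ∘ γ₂₁` (with `γ₁₂(γ₂₁(∞)) = ∞`), the open
intervals between them are listed in increasing order and are disjoint, and
`γ₁₂(γ₂₁(s)) < s` on each of them. In particular only `Mhi ℓ` can be `∞`. -/
structure LocalSmallGain (γ₁₂ γ₂₁ : ℝ → ℝ) (ℓ : ℕ) (Mlo : ℕ → ℝ) (Mhi : ℕ → WithTop ℝ) :
    Prop where
  one_le : 1 ≤ ℓ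
  nonneg : ∀ k ∈ Icc 1 ℓ, 0 ≤ Mlo k
  lt : ∀ k ∈ Icc 1 ℓ, (Mlo k : WithTop ℝ) < Mhi k
  ordered : ∀ k ∈ Icc 1 ℓ, k < ℓ → Mhi k ≤ (Mlo (k + 1) : WithTop ℝ)
  fixed_lo : ∀ k ∈ Icc 1 ℓ, γ₁₂ (γ₂₁ (Mlo k)) = Mlo k
  fixed_hi : ∀ k ∈ Icc 1 ℓ, (Mhi k).map (γ₁₂ ∘ γ₂₁) = Mhi k
  small_gain : ∀ k ∈ Icc 1 ℓ, ∀ s : ℝ, Mlo k < s → (s : WithTop ℝ) < Mhi k → γ₁₂ (γ₂₁ s) < s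

/-- The sublevel set `{x : V x ≤ δ}` for `δ ∈ ℝ ∪ {∞}`. -/
def sublevel {n : ℕ} (V : E n → ℝ) (δ : WithTop ℝ) : Set (E n) :=
  {x | (V x : WithTop ℝ) ≤ δ}

/-- The attracting set with lower endpoint `M`. -/
def setA {n₁ n₂ : ℕ} (V₁ : E n₁ → ℝ) (V₂ : E n₂ → ℝ) (γ₁₂ γ₂₁ : ℝ → ℝ) (M : ℝ) :
    Set (Pair n₁ n₂) :=
  {x | x.fst ∈ sublevel V₁ ((max M (γ₁₂ M) : ℝ) : WithTop ℝ) ∧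
    x.snd ∈ sublevel V₂ ((max (γ₂₁ M) (γ₂₁ (γ₂₁ M)) : ℝ) : WithTop ℝ)}

/-- The set of initial states with upper endpoint `M` (the whole space if `M = ∞`). -/
def setB {n₁ n₂ : ℕ} (V₁ : E n₁ → ℝ) (V₂ : E n₂ → ℝ) (γ₂₁ : ℝ → ℝ) (M : WithTop ℝ) :
    Set (Pair n₁ n₂) :=
  {x | x.fst ∈ sublevel V₁ M ∧ x.snd ∈ sublevel V₂ (M.map γ₂₁)}

/-- The right-hand side `f = (f₁, f₂)` of the interconnection. -/
def interconnection {n₁ n₂ m₁ m₂ : ℕ} (f₁ : E n₁ → E n₂ → E m₁ → E n₁)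
    (f₂ : E n₁ → E n₂ → E m₂ → E n₂) (x : Pair n₁ n₂) (u : Pair m₁ m₂) : Pair n₁ n₂ :=
  WithLp.toLp 2 (f₁ x.fst x.snd u.fst, f₂ x.fst x.snd u.snd)

/-- Measurable, essentially bounded inputs on `[0,∞)`. -/
def IsInput {m₁ m₂ : ℕ} (u : ℝ → Pair m₁ m₂) : Prop :=
  MemLp u ⊤ (volume.restrict (Ici 0))

/-- `|u|_∞`, the essential supremum of `|u(t)|` over `t ≥ 0`. -/
noncomputable def inputNorm {m₁ m₂ : ℕ} (u : ℝ → Pair m₁ m₂) : ℝ :=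
  (eLpNorm u ⊤ (volume.restrict (Ici 0))).toReal

/-- `x` is a (Carathéodory) solution on `[0,∞)` of `ẋ = F(x, u(t))`, `x(0) = x₀`, that is, an
absolutely continuous function satisfying the equation for almost every `t`. -/
def IsSolution {n₁ n₂ m₁ m₂ : ℕ} (F : Pair n₁ n₂ → Pair m₁ m₂ → Pair n₁ n₂)
    (u : ℝ → Pair m₁ m₂) (x₀ : Pair n₁ n₂) (x : ℝ → Pair n₁ n₂) : Prop :=
  ∀ t, 0 ≤ t → IntervalIntegrable (fun s => F (x s) (u s)) volume 0 t ∧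
    x t = x₀ + ∫ s in (0 : ℝ)..t, F (x s) (u s)

/-- `x(t)` converges, as `t → ∞`, to the closed neighbourhood of `A` of radius `r`. -/
def ConvergesToNhd {n₁ n₂ : ℕ} (x : ℝ → Pair n₁ n₂) (A : Set (Pair n₁ n₂)) (r : ℝ) : Prop :=
  Tendsto (fun t => Metric.infDist (x t) (Metric.cthickening r A)) atTop (𝓝 0)

/-- For the input `u`, almost all solutions starting in `B` converge to the neighbourhood of `A` of
radius `r`: for almost every `x₀ ∈ B` the solution exists on all of `[0,∞)` and converges. -/
def AlmostAllConverge {n₁ n₂ m₁ m₂ : ℕ} (F : Pair n₁ n₂ → Pair m₁ m₂ → Pair n₁ n₂)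
    (u : ℝ → Pair m₁ m₂) (B A : Set (Pair n₁ n₂)) (r : ℝ) : Prop :=
  ∀ᵐ x₀ : Pair n₁ n₂, x₀ ∈ B →
    (∃ x, IsSolution F u x₀ x) ∧ ∀ x, IsSolution F u x₀ x → ConvergesToNhd x A r

end FeedbackISS

open FeedbackISS

/-! The decay estimate holds only almost everywhere and a trajectory may run inside the exceptional
null set, so the chain rule for `V ∘ x` is not available. The remedy is to freeze the direction `v =
g y₀ z w`. Near `y₀` the bound on `fderiv ℝ V y v` holds for almost every `y` up to `ε`, so by
Fubini it can be integrated on almost every line parallel to `v`, and by continuity on every short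
segment (`le_add_of_ae_fderiv_le`). A trajectory is tangent to `v` and `V` is locally Lipschitz,
which gives decay along the trajectory itself (`IsISSLyapunov.deriv_comp_le`).

Each subsystem therefore has a transient gain (`IsISSLyapunov.le_max`) and an asymptotic gain
(`IsISSLyapunov.asymptotic_gain`). Closing the loop, both the maximum and the upper limit of `V₁`
along a solution are bounded by their own image under `γ₁₂ ∘ γ₂₁`, up to terms from the input and,
for the maximum, from the initial state. The small-gain inequality removes the loop term: solutions
starting strictly below the upper endpoint stay there, exist globally, and end up below the lower
endpoint or the input level (`IsFeedback.exists_and_asymptotic_bound`).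

Strictness costs only a null set of initial states, because positive level sets of an ISS-Lyapunov
function are null: locally, each line parallel to `v` meets them at most once
(`IsISSLyapunov.volume_level_eq_zero`). The limiting boxes shrink to `setA` with the input, which
supplies the radius `γ`. When the last interval is unbounded, inputs too large for the `k`-th
interval are handled by the last one, with `γ` large enough to absorb the difference. -/

namespace FeedbackISS

open scoped NNReal

/-! ### Integrating almost everywhere derivative bounds -/

theorem le_add_of_ae_deriv_le {f : ℝ → ℝ} {a b c : ℝ} (hab : a ≤ b)
    (hf : AbsolutelyContinuousOnInterval f a b)
    (h : ∀ᵐ t, t ∈ Ioo a b → deriv f t ≤ c) : f b ≤ f a + c * (b - a) := by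
  have h1 := hf.integral_deriv_eq_sub
  have h2 : ∫ t in a..b, deriv f t ≤ ∫ _ in a..b, c := by
    apply intervalIntegral.integral_mono_ae_restrict hab hf.intervalIntegrable_deriv
      intervalIntegrable_const
    have h3 : ∀ᵐ t, t ≠ b := by simp [ae_iff, measure_singleton]
    have h4 : ∀ᵐ t, t ≠ a := by simp [ae_iff, measure_singleton]
    refine (ae_restrict_iff' measurableSet_Icc).2 ?_
    filter_upwards [h, h3, h4] with t ht hb ha hmem
    exact ht ⟨lt_of_le_of_ne hmem.1 (Ne.symm ha), lt_of_le_of_ne hmem.2 hb⟩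
  rw [intervalIntegral.integral_const, smul_eq_mul] at h2
  nlinarith

/-- Integrating an almost everywhere bound on a directional derivative along segments. -/
theorem le_add_of_ae_fderiv_le {n : ℕ} {V : E n → ℝ} {y₀ : E n} {r : ℝ} {C : ℝ≥0} {v : E n} {c : ℝ}
    (hL : LipschitzOnWith C V (Metric.ball y₀ r))
    (h : ∀ᵐ y, y ∈ Metric.ball y₀ r → fderiv ℝ V y v ≤ c) {y : E n} {τ : ℝ}
    (hy : y ∈ Metric.ball y₀ r) (hτ : 0 ≤ τ) (hyτ : y + τ • v ∈ Metric.ball y₀ r) :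
    V (y + τ • v) ≤ V y + c * τ := by
  have hG : ∀ᵐ y, y ∈ Metric.ball y₀ r → DifferentiableAt ℝ V y ∧ fderiv ℝ V y v ≤ c := by
    filter_upwards [h, hL.ae_differentiableWithinAt_of_mem (μ := volume)] with z hz hz' hmem
    exact ⟨(hz' hmem).differentiableAt (Metric.isOpen_ball.mem_nhds hmem), hz hmem⟩
  obtain ⟨s, hs0, hs, hsG⟩ := hG.exists_measurable_mem
  -- Fubini: on almost every line parallel to `v`, almost every point is good.
  have hline := (ae_ae_add_linearMap_mem_iff (LinearMap.toSpanSingleton ℝ (E n) v)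
    (volume : Measure ℝ) (volume : Measure (E n)) hs).2 hs0
  have hgood : ∀ᵐ z : E n, z ∈ Metric.ball y₀ r → z + τ • v ∈ Metric.ball y₀ r →
      V (z + τ • v) ≤ V z + c * τ := by
    filter_upwards [hline] with z hz hz1 hz2
    have hseg : ∀ t ∈ Icc 0 τ, z + t • v ∈ Metric.ball y₀ r := by
      intro t ht
      rcases hτ.eq_or_lt with h0 | h0
      · obtain rfl : t = 0 := le_antisymm (h0 ▸ ht.2) ht.1
        simpa using hz1
      · have := (convex_ball y₀ r).add_smul_sub_mem hz1 hz2
          (t := t / τ) ⟨by have := ht.1; positivity, (div_le_one h0).2 ht.2⟩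
        simpa [smul_smul, div_mul_cancel₀ _ h0.ne'] using this
    have hlip : LipschitzOnWith (C * ‖v‖₊) (fun t : ℝ => V (z + t • v)) (uIcc 0 τ) := by
      rw [uIcc_of_le hτ]
      refine hL.comp (g := V) (f := fun t : ℝ => z + t • v) ?_ hseg
      refine LipschitzWith.lipschitzOnWith (LipschitzWith.of_dist_le_mul fun a b => ?_)
      rw [dist_add_left, dist_eq_norm, ← sub_smul, norm_smul, dist_eq_norm, mul_comm]
      rfl
    have := le_add_of_ae_deriv_le (c := c) hτ hlip.absolutelyContinuousOnInterval ?_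
    · simpa using this
    · filter_upwards [hz] with t ht htm
      have h1 := hsG _ ht (hseg t (Ioo_subset_Icc_self htm))
      simp only [LinearMap.toSpanSingleton_apply] at h1
      have h2 : HasDerivAt (fun t : ℝ => z + t • v) v t := by
        simpa using ((hasDerivAt_id t).smul_const v).const_add z
      have h3 := h1.1.hasFDerivAt.comp_hasDerivAt t h2
      have h4 := h3.deriv
      simp only [Function.comp_def] at h4
      rw [h4]
      exact h1.2
  -- Both sides are continuous in the base point, so a failure at `y` would persist on an open set,
  -- which meets the full-measure set of good base points.
  by_contra! hcon
  have hc : ContinuousOn V (Metric.ball y₀ r) := hL.continuousOn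
  have hadd : ContinuousAt (fun z : E n => z + τ • v) y := by fun_prop
  have e1 : ∀ᶠ z in 𝓝 y, z ∈ Metric.ball y₀ r := Metric.isOpen_ball.mem_nhds hy
  have e2 : ∀ᶠ z in 𝓝 y, z + τ • v ∈ Metric.ball y₀ r :=
    hadd.eventually (Metric.isOpen_ball.mem_nhds hyτ)
  have c1 : ContinuousAt (fun z => V (z + τ • v)) y :=
    ContinuousAt.comp (g := V) (hc.continuousAt (Metric.isOpen_ball.mem_nhds hyτ)) hadd
  have c2 : ContinuousAt (fun z => V z + c * τ) y :=
    (hc.continuousAt (Metric.isOpen_ball.mem_nhds hy)).add continuousAt_const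
  have e3 := c2.eventually_lt c1 hcon
  obtain ⟨z, hz, hz1, hz2, hz3⟩ :=
    (Measure.dense_of_ae hgood).inter_nhds_nonempty (e1.and (e2.and e3))
  exact absurd (hz hz1 hz2) (not_le.2 hz3)

/-! ### Elementary properties of class `K∞` -/

theorem IsKInfty.nonneg {γ : ℝ → ℝ} (h : IsKInfty γ) {s : ℝ} (hs : 0 ≤ s) : 0 ≤ γ s := by
  have := h.strictMonoOn.monotoneOn (self_mem_Ici) hs hs
  rwa [h.map_zero] at this

theorem IsKInfty.mono {γ : ℝ → ℝ} (h : IsKInfty γ) {s t : ℝ} (hs : 0 ≤ s) (hst : s ≤ t) :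
    γ s ≤ γ t := h.strictMonoOn.monotoneOn hs (mem_Ici.2 (hs.trans hst)) hst

theorem IsKInfty.pos {γ : ℝ → ℝ} (h : IsKInfty γ) {s : ℝ} (hs : 0 < s) : 0 < γ s := by
  have := h.strictMonoOn self_mem_Ici (mem_Ici.2 hs.le) hs
  rwa [h.map_zero] at this

theorem IsKInfty.continuous_comp {X : Type*} [TopologicalSpace X] {γ : ℝ → ℝ} (h : IsKInfty γ)
    {φ : X → ℝ} (hφ : Continuous φ) (h0 : ∀ x, 0 ≤ φ x) : Continuous fun x => γ (φ x) :=
  h.continuousOn.comp_continuous hφ h0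

theorem IsKInfty.map_max {γ : ℝ → ℝ} (h : IsKInfty γ) {s t : ℝ} (hs : 0 ≤ s) (ht : 0 ≤ t) :
    γ (max s t) = max (γ s) (γ t) := by
  rcases le_total s t with hst | hst
  · rw [max_eq_right hst, max_eq_right (h.mono hs hst)]
  · rw [max_eq_left hst, max_eq_left (h.mono ht hst)]

/-! ### Decay of a nonsmooth Lyapunov function along trajectories -/

section Decay

variable {n n' m : ℕ} {g : E n → E n' → E m → E n} {V : E n → ℝ} {W : E n' → ℝ}
  {γint γext α : ℝ → ℝ}

/-- For almost every `y` the decay estimate holds at all points where the gain condition is strict. -/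
theorem IsISSLyapunov.ae_forall_decay (hV : IsISSLyapunov g V W γint γext α)
    (hg : Continuous fun p : E n × E n' × E m => g p.1 p.2.1 p.2.2) (hW : IsStorage W) :
    ∀ᵐ y, ∀ z w, max (γint (W z)) (γext ‖w‖) < V y → fderiv ℝ V y (g y z w) ≤ -α ‖y‖ := by
  have h := hV.decay
  rw [Measure.volume_eq_prod] at h
  filter_upwards [Measure.ae_ae_of_ae_prod h] with y hy z w hzw
  -- For fixed `y` the derivative is a fixed linear map, so the strict gain condition and a failure
  -- of the bound are both open in `(z, w)`.
  by_contra! hcon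
  have hm : Continuous fun p : E n' × E m => max (γint (W p.1)) (γext ‖p.2‖) :=
    (hV.gain_int.continuous_comp (hW.locallyLipschitz.continuous.comp continuous_fst)
      fun p => hW.nonneg _).max
    (hV.gain_ext.continuous_comp (continuous_norm.comp continuous_snd) fun p => norm_nonneg _)
  have hd : Continuous fun p : E n' × E m => fderiv ℝ V y (g y p.1 p.2) :=
    (fderiv ℝ V y).continuous.comp (hg.comp (Continuous.prodMk_right y))
  have e1 : ∀ᶠ p in 𝓝 (z, w), max (γint (W p.1)) (γext ‖p.2‖) < V y :=
    hm.continuousAt.eventually_lt continuousAt_const hzw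
  have e2 : ∀ᶠ p in 𝓝 (z, w), -α ‖y‖ < fderiv ℝ V y (g y p.1 p.2) :=
    continuousAt_const.eventually_lt hd.continuousAt hcon
  obtain ⟨p, hp, hp1, hp2⟩ := (Measure.dense_of_ae hy).inter_nhds_nonempty (e1.and e2)
  exact absurd (hp hp1.le) (not_le.2 hp2)

/-- Near a point of strict gain condition, the decay estimate holds up to `ε` for the constant
direction `g y₀ z w`. -/
theorem IsISSLyapunov.exists_ball_decay (hV : IsISSLyapunov g V W γint γext α)
    (hg : Continuous fun p : E n × E n' × E m => g p.1 p.2.1 p.2.2) (hW : IsStorage W)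
    {y₀ : E n} {z : E n'} {w : E m} (h : max (γint (W z)) (γext ‖w‖) < V y₀) {ε : ℝ} (hε : 0 < ε) :
    ∃ r > 0, ∃ C : ℝ≥0, LipschitzOnWith C V (Metric.ball y₀ r) ∧
      ∀ᵐ y, y ∈ Metric.ball y₀ r → fderiv ℝ V y (g y₀ z w) ≤ -α ‖y₀‖ + ε := by
  obtain ⟨C, s, hs, hC⟩ := hV.storage.locallyLipschitz y₀
  have hVc := hV.storage.locallyLipschitz.continuous
  have e1 : ∀ᶠ y in 𝓝 y₀, max (γint (W z)) (γext ‖w‖) < V y :=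
    continuousAt_const.eventually_lt hVc.continuousAt h
  have hα : Continuous fun y : E n => α ‖y‖ :=
    hV.rate.continuous_comp continuous_norm fun _ => norm_nonneg _
  have hgc : Continuous fun y => g y z w := hg.comp (Continuous.prodMk_left (z, w))
  -- Freezing the direction at `y₀` costs at most the Lipschitz constant of `V` times the change of
  -- `g`, which vanishes at `y₀`.
  have hb : Continuous fun y => -α ‖y‖ + C * ‖g y₀ z w - g y z w‖ :=
    hα.neg.add (continuous_const.mul (continuous_const.sub hgc).norm)
  have e2 : ∀ᶠ y in 𝓝 y₀, -α ‖y‖ + C * ‖g y₀ z w - g y z w‖ < -α ‖y₀‖ + ε :=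
    hb.continuousAt.eventually_lt continuousAt_const (by simpa using hε)
  obtain ⟨r, hr, hball⟩ := Metric.eventually_nhds_iff_ball.1
    (e1.and (e2.and (Filter.eventually_mem_set.2 hs)))
  refine ⟨r, hr, C, hC.mono fun y hy => (hball y hy).2.2, ?_⟩
  filter_upwards [hV.ae_forall_decay hg hW] with y hy hmem
  obtain ⟨h1, h2, -⟩ := hball y hmem
  have h3 := hy z w h1
  have h4 : ‖fderiv ℝ V y‖ ≤ C := norm_fderiv_le_of_lipschitzOn ℝ
    (Metric.isOpen_ball.mem_nhds hmem) (hC.mono fun y hy => (hball y hy).2.2)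
  have h5 : fderiv ℝ V y (g y₀ z w - g y z w) ≤ C * ‖g y₀ z w - g y z w‖ :=
    (le_abs_self _).trans ((fderiv ℝ V y).le_of_opNorm_le h4 _)
  rw [map_sub] at h5
  linarith

theorem IsStorage.map_zero {V : E n → ℝ} (h : IsStorage V) : V 0 = 0 := by
  obtain ⟨a, b, -, hb, hab⟩ := h.bounds
  have := (hab 0).2
  rw [norm_zero, hb.map_zero] at this
  exact le_antisymm this (h.nonneg 0)

/-- With the other state and the input at zero the gains vanish, so the gain condition is strict
wherever `V > 0`. Hence `V` strictly decreases along short segments in the direction `g y₀ 0 0`, a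
line in this direction meets the level set at most once near `y₀`, and Fubini applies. -/
theorem IsISSLyapunov.volume_level_eq_zero (hV : IsISSLyapunov g V W γint γext α)
    (hg : Continuous fun p : E n × E n' × E m => g p.1 p.2.1 p.2.2) (hW : IsStorage W)
    {M : ℝ} (hM : 0 < M) : volume {y | V y = M} = 0 := by
  have hVc := hV.storage.locallyLipschitz.continuous
  refine measure_null_of_locally_null _ fun y₀ hy₀ => ?_
  have hy₀' : V y₀ = M := hy₀
  have hne : 0 < ‖y₀‖ := by
    rw [norm_pos_iff]
    rintro rfl
    rw [hV.storage.map_zero] at hy₀'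
    exact hM.ne hy₀'
  have hαp := hV.rate.pos hne
  obtain ⟨r, hr, C, hC, hdec⟩ := hV.exists_ball_decay (y₀ := y₀) (z := 0) (w := 0) hg hW
    (by rw [hW.map_zero, norm_zero, hV.gain_int.map_zero, hV.gain_ext.map_zero, hy₀']
        simpa using hM) (half_pos hαp)
  set v := g y₀ 0 0
  have hmeas : MeasurableSet ({y | V y = M} ∩ Metric.ball y₀ r) :=
    (measurableSet_eq_fun hVc.measurable measurable_const).inter measurableSet_ball
  refine ⟨{y | V y = M} ∩ Metric.ball y₀ r,
    inter_mem_nhdsWithin _ (Metric.ball_mem_nhds y₀ hr), ?_⟩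
  rw [measure_eq_zero_iff_ae_notMem]
  refine (ae_ae_add_linearMap_mem_iff (LinearMap.toSpanSingleton ℝ (E n) v)
    (volume : Measure ℝ) (volume : Measure (E n)) hmeas.compl).1 (Eventually.of_forall fun y => ?_)
  have hsub : {t : ℝ | y + t • v ∈ {y | V y = M} ∩ Metric.ball y₀ r}.Subsingleton := by
    intro s hs t ht
    by_contra hst
    wlog hlt : s < t generalizing s t
    · exact this ht hs (Ne.symm hst) (lt_of_le_of_ne (not_lt.1 hlt) (Ne.symm hst))
    have hadd : y + s • v + (t - s) • v = y + t • v := by rw [sub_smul]; abel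
    have := le_add_of_ae_fderiv_le hC hdec hs.2 (sub_nonneg.2 hlt.le) (by rw [hadd]; exact ht.2)
    rw [hadd, show V (y + t • v) = M from ht.1, show V (y + s • v) = M from hs.1] at this
    nlinarith
  have := hsub.measure_zero (volume : Measure ℝ)
  rw [measure_eq_zero_iff_ae_notMem] at this
  simpa using this

/-- The point `x (t + τ)` differs from the tangent point `x t + τ • v` by `o(τ)`. On the tangent
segment `V` decays by `exists_ball_decay`, and the local Lipschitz constant of `V` controls the
difference. Differentiability of `V` at `x t` is never needed. -/
theorem IsISSLyapunov.deriv_comp_le (hV : IsISSLyapunov g V W γint γext α)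
    (hg : Continuous fun p : E n × E n' × E m => g p.1 p.2.1 p.2.2) (hW : IsStorage W)
    {x : ℝ → E n} {t : ℝ} {z : E n'} {w : E m} (hx : HasDerivAt x (g (x t) z w) t)
    (h : max (γint (W z)) (γext ‖w‖) < V (x t)) (hd : DifferentiableAt ℝ (fun s => V (x s)) t) :
    deriv (fun s => V (x s)) t ≤ -α ‖x t‖ := by
  refine le_of_forall_pos_le_add fun ε hε => ?_
  obtain ⟨r, hr, C, hC, hdec⟩ := hV.exists_ball_decay hg hW h hε
  -- The segment estimate is for `τ ≥ 0`, so right slopes are compared.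
  set v := g (x t) z w
  have h1 := (hasDerivAt_iff_tendsto_slope_zero.1 hd.hasDerivAt).mono_left
    (nhdsWithin_mono (0 : ℝ) (s := Ioi 0) fun y hy => (ne_of_gt hy))
  have h2 := (hasDerivAt_iff_tendsto_slope_zero.1 hx).mono_left
    (nhdsWithin_mono (0 : ℝ) (s := Ioi 0) fun y hy => (ne_of_gt hy))
  have h3 : Tendsto (fun τ : ℝ => -α ‖x t‖ + ε + C * ‖τ⁻¹ • (x (t + τ) - x t) - v‖) (𝓝[>] 0)
      (𝓝 (-α ‖x t‖ + ε)) := by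
    have := ((h2.sub_const v).norm.const_mul (C : ℝ)).const_add (-α ‖x t‖ + ε)
    simpa using this
  refine le_of_tendsto_of_tendsto h1 h3 ?_
  have c1 : ContinuousAt (fun τ : ℝ => x (t + τ)) 0 :=
    ContinuousAt.comp (g := x) (by simpa using hx.continuousAt) (by fun_prop)
  have c2 : ContinuousAt (fun τ : ℝ => x t + τ • v) 0 := by fun_prop
  have e1 : ∀ᶠ τ in 𝓝[>] (0 : ℝ), x (t + τ) ∈ Metric.ball (x t) r :=
    nhdsWithin_le_nhds (c1.eventually (Metric.isOpen_ball.mem_nhds (by simpa using hr)))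
  have e2 : ∀ᶠ τ in 𝓝[>] (0 : ℝ), x t + τ • v ∈ Metric.ball (x t) r :=
    nhdsWithin_le_nhds (c2.eventually (Metric.isOpen_ball.mem_nhds (by simpa using hr)))
  filter_upwards [e1, e2, self_mem_nhdsWithin] with τ hτ1 hτ2 hτ
  have hτ : 0 < τ := hτ
  have h4 := le_add_of_ae_fderiv_le hC hdec (Metric.mem_ball_self hr) hτ.le hτ2
  have h5 := hC.dist_le_mul _ hτ1 _ hτ2
  have h6 : dist (x (t + τ)) (x t + τ • v) = τ * ‖τ⁻¹ • (x (t + τ) - x t) - v‖ := by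
    rw [dist_eq_norm, ← norm_smul_of_nonneg hτ.le, smul_sub, smul_smul, mul_inv_cancel₀ hτ.ne',
      one_smul, sub_sub]
  rw [h6, Real.dist_eq] at h5
  have h7 := (le_abs_self _).trans h5
  rw [smul_eq_mul, inv_mul_le_iff₀ hτ]
  nlinarith

end Decay

/-! ### Transient and asymptotic gains of one subsystem -/

/-- Lipschitz trajectories of `ẋ = g(x, z(t), w(t))` on `[0,T]`. -/
structure IsTrajectory {n n' m : ℕ} (g : E n → E n' → E m → E n) (x : ℝ → E n) (z : ℝ → E n')
    (w : ℝ → E m) (T : ℝ) : Prop where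
  lipschitz : ∃ C : ℝ≥0, LipschitzOnWith C x (Icc 0 T)
  hasDerivAt : ∀ᵐ t, t ∈ Ioo 0 T → HasDerivAt x (g (x t) (z t) (w t)) t

theorem IsKInfty.tendsto_nhdsGT {γ : ℝ → ℝ} (h : IsKInfty γ) : Tendsto γ (𝓝[>] 0) (𝓝 0) := by
  have := (h.continuousOn 0 self_mem_Ici).mono Ioi_subset_Ici_self
  rwa [ContinuousWithinAt, h.map_zero] at this

theorem IsKInfty.exists_pos_lt {γ : ℝ → ℝ} (h : IsKInfty γ) {ε : ℝ} (hε : 0 < ε) :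
    ∃ ρ > 0, γ ρ < ε := by
  obtain ⟨ρ, h1, h2⟩ :=
    ((h.tendsto_nhdsGT.eventually (gt_mem_nhds hε)).and self_mem_nhdsWithin).exists
  exact ⟨ρ, h2, h1⟩

section Gain

variable {n n' m : ℕ} {g : E n → E n' → E m → E n} {V : E n → ℝ} {W : E n' → ℝ}
  {γint γext α : ℝ → ℝ} {x : ℝ → E n} {z : ℝ → E n'} {w : ℝ → E m} {T a b ω U : ℝ}

/-- `V ∘ x` is Lipschitz on a compact interval, so `deriv_comp_le` integrates. The rate `κ = 0`
serves for invariance, `κ > 0` for entry in finite time. -/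
theorem IsISSLyapunov.le_sub_of_forall_lt (hV : IsISSLyapunov g V W γint γext α)
    (hg : Continuous fun p : E n × E n' × E m => g p.1 p.2.1 p.2.2) (hW : IsStorage W)
    (hx : IsTrajectory g x z w T) (ha : 0 ≤ a) (hab : a ≤ b) (hb : b ≤ T)
    (hω : ∀ t ∈ Ioo a b, W (z t) ≤ ω) (hU : ∀ᵐ t, t ∈ Ioo a b → ‖w t‖ ≤ U)
    (hgt : ∀ t ∈ Ioo a b, max (γint ω) (γext U) < V (x t)) {κ : ℝ}
    (hκ : ∀ t ∈ Ioo a b, κ ≤ α ‖x t‖) : V (x b) ≤ V (x a) - κ * (b - a) := by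
  obtain ⟨C, hC⟩ := hx.lipschitz
  have hC' : LipschitzOnWith C x (uIcc a b) := by
    rw [uIcc_of_le hab]
    exact hC.mono (Icc_subset_Icc ha hb)
  obtain ⟨K, hK⟩ := (hV.storage.locallyLipschitz.locallyLipschitzOn
    (s := x '' uIcc a b)).exists_lipschitzOnWith_of_compact
    (isCompact_uIcc.image_of_continuousOn hC'.continuousOn)
  have hac := (hK.comp hC' (mapsTo_image x _)).absolutelyContinuousOnInterval
  have := le_add_of_ae_deriv_le (c := -κ) hab hac ?_
  · simp only [Function.comp_apply] at this
    linarith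
  · filter_upwards [hac.ae_differentiableAt, hx.hasDerivAt, hU] with t h1 h2 h3 ht
    have hlt : max (γint (W (z t))) (γext ‖w t‖) < V (x t) :=
      (max_le_max (hV.gain_int.mono (hW.nonneg _) (hω t ht))
        (hV.gain_ext.mono (norm_nonneg _) (h3 ht))).trans_lt (hgt t ht)
    have h4 := hV.deriv_comp_le hg hW (h2 ⟨ha.trans_lt ht.1, ht.2.trans_le hb⟩) hlt
      (h1 (by rw [uIcc_of_le hab]; exact Ioo_subset_Icc_self ht))
    exact h4.trans (neg_le_neg (hκ t ht))

/-- After the last time `t₀` at which `V ∘ x` is at most the claimed bound, the gain condition is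
strict up to `b`, so `V ∘ x` cannot have grown since `t₀`. -/
theorem IsISSLyapunov.le_max (hV : IsISSLyapunov g V W γint γext α)
    (hg : Continuous fun p : E n × E n' × E m => g p.1 p.2.1 p.2.2) (hW : IsStorage W)
    (hx : IsTrajectory g x z w T) (ha : 0 ≤ a) (hab : a ≤ b) (hb : b ≤ T)
    (hω : ∀ t ∈ Ioo a b, W (z t) ≤ ω) (hU : ∀ᵐ t, t ∈ Ioo a b → ‖w t‖ ≤ U) :
    V (x b) ≤ max (V (x a)) (max (γint ω) (γext U)) := by
  by_contra! hcon
  set c := max (V (x a)) (max (γint ω) (γext U))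
  obtain ⟨C, hC⟩ := hx.lipschitz
  have hcont : ContinuousOn (fun t => V (x t)) (Icc a b) :=
    hV.storage.locallyLipschitz.continuous.comp_continuousOn
      (hC.continuousOn.mono (Icc_subset_Icc ha hb))
  have hS : IsCompact (Icc a b ∩ (fun t => V (x t)) ⁻¹' Iic c) :=
    isCompact_Icc.of_isClosed_subset
      (hcont.preimage_isClosed_of_isClosed isClosed_Icc isClosed_Iic) inter_subset_left
  obtain ⟨t₀, ⟨ht₀, ht₀c⟩, hmax⟩ :=
    hS.exists_isGreatest ⟨a, left_mem_Icc.2 hab, le_max_left (V (x a)) _⟩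
  have hgt : ∀ t ∈ Ioo t₀ b, c < V (x t) := by
    intro t ht
    by_contra! hle
    exact absurd (hmax ⟨⟨ht₀.1.trans ht.1.le, ht.2.le⟩, hle⟩) (not_le.2 ht.1)
  have hsub : Ioo t₀ b ⊆ Ioo a b := Ioo_subset_Ioo_left ht₀.1
  have := hV.le_sub_of_forall_lt (κ := 0) hg hW hx (ha.trans ht₀.1) ht₀.2 hb
    (fun t ht => hω t (hsub ht)) (hU.mono fun t h ht => h (hsub ht))
    (fun t ht => (le_max_right _ _).trans_lt (hgt t ht))
    (fun t _ => hV.rate.nonneg (norm_nonneg _))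
  have h1 : V (x t₀) ≤ c := ht₀c
  linarith

/-- Above the level the state stays away from `0` and the decay rate is bounded below, so the level
is reached in finite time; `le_max` then keeps `V` below it. -/
theorem IsISSLyapunov.eventually_le (hV : IsISSLyapunov g V W γint γext α)
    (hg : Continuous fun p : E n × E n' × E m => g p.1 p.2.1 p.2.2) (hW : IsStorage W)
    (hx : ∀ T, 0 ≤ T → IsTrajectory g x z w T) (hω : ∀ᶠ t in atTop, W (z t) ≤ ω) (hU0 : 0 ≤ U)
    (hU : ∀ᵐ t, 0 ≤ t → ‖w t‖ ≤ U) {ε : ℝ} (hε : 0 < ε) :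
    ∀ᶠ t in atTop, V (x t) ≤ max (γint ω) (γext U) + ε := by
  obtain ⟨T₀, hT₀⟩ := eventually_atTop.1 (hω.and (eventually_ge_atTop 0))
  have h0 : 0 ≤ T₀ := (hT₀ T₀ le_rfl).2
  have hc : 0 ≤ max (γint ω) (γext U) := le_max_of_le_right (hV.gain_ext.nonneg hU0)
  have hU' : ∀ a, 0 ≤ a → ∀ b, ∀ᵐ t, t ∈ Ioo a b → ‖w t‖ ≤ U := fun a ha b =>
    hU.mono fun t h ht => h (ha.trans ht.1.le)
  obtain ⟨t₁, ht₁, hle⟩ : ∃ t₁, T₀ ≤ t₁ ∧ V (x t₁) ≤ max (γint ω) (γext U) + ε := by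
    by_contra! hcon
    obtain ⟨αlo, αhi, -, hαhi, hb⟩ := hV.storage.bounds
    obtain ⟨ρ, hρ, hρε⟩ := hαhi.exists_pos_lt hε
    have hκ := hV.rate.pos hρ
    have hnorm : ∀ t, T₀ ≤ t → α ρ ≤ α ‖x t‖ := by
      intro t ht
      refine hV.rate.mono hρ.le ?_
      by_contra! hlt
      have h1 := hαhi.mono (norm_nonneg (x t)) hlt.le
      have h2 := (hb (x t)).2
      have h3 := hcon t ht
      linarith
    -- Decay at rate `α ρ` for this long would bring `V` down to `-1`.
    have hτ : 0 ≤ (V (x T₀) + 1) / α ρ := by have := hV.storage.nonneg (x T₀); positivity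
    have := hV.le_sub_of_forall_lt hg hW (a := T₀) (b := T₀ + (V (x T₀) + 1) / α ρ) (ω := ω)
      (hx _ (add_nonneg h0 hτ)) h0 (by linarith) le_rfl
      (fun t ht => (hT₀ t ht.1.le).1) (hU' _ h0 _)
      (fun t ht => by have := hcon t ht.1.le; linarith) (fun t ht => hnorm t ht.1.le)
    rw [add_sub_cancel_left, mul_div_cancel₀ _ hκ.ne'] at this
    have := hV.storage.nonneg (x (T₀ + (V (x T₀) + 1) / α ρ))
    linarith
  filter_upwards [eventually_ge_atTop t₁] with t ht
  have h1 : 0 ≤ t₁ := h0.trans ht₁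
  refine (hV.le_max hg hW (hx t (h1.trans ht)) h1 ht le_rfl
    (fun s hs => (hT₀ s (ht₁.trans hs.1.le)).1) (hU' _ h1 _)).trans ?_
  exact max_le hle (by linarith)

/-- Asymptotic gain: asymptotic bounds on `W ∘ z` yield asymptotic bounds on `V ∘ x`. -/
theorem IsISSLyapunov.asymptotic_gain (hV : IsISSLyapunov g V W γint γext α)
    (hg : Continuous fun p : E n × E n' × E m => g p.1 p.2.1 p.2.2) (hW : IsStorage W)
    (hx : ∀ T, 0 ≤ T → IsTrajectory g x z w T) (hω0 : 0 ≤ ω)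
    (hω : ∀ ε > 0, ∀ᶠ t in atTop, W (z t) ≤ ω + ε) (hU0 : 0 ≤ U)
    (hU : ∀ᵐ t, 0 ≤ t → ‖w t‖ ≤ U) :
    ∀ ε > 0, ∀ᶠ t in atTop, V (x t) ≤ max (γint ω) (γext U) + ε := by
  intro ε hε
  have hc : Tendsto (fun η => γint (ω + η)) (𝓝[>] 0) (𝓝 (γint ω)) := by
    have h1 : Tendsto (fun η : ℝ => ω + η) (𝓝[>] 0) (𝓝[≥] ω) := by
      refine tendsto_nhdsWithin_iff.2 ⟨?_, ?_⟩
      · have : Tendsto (fun η : ℝ => ω + η) (𝓝 0) (𝓝 (ω + 0)) :=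
          tendsto_const_nhds.add tendsto_id
        rw [add_zero] at this
        exact this.mono_left nhdsWithin_le_nhds
      · filter_upwards [self_mem_nhdsWithin] with η hη
        have : (0 : ℝ) < η := hη
        simp only [mem_Ici]; linarith
    have h2 := (hV.gain_int.continuousOn ω hω0).mono (Ici_subset_Ici.2 hω0)
    exact h2.tendsto.comp h1
  obtain ⟨η, hη, hη0⟩ := ((hc.eventually (gt_mem_nhds
    (show γint ω < γint ω + ε / 2 by linarith))).and self_mem_nhdsWithin).exists
  filter_upwards [hV.eventually_le hg hW hx (hω η hη0) hU0 hU (half_pos hε)] with t ht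
  have : max (γint (ω + η)) (γext U) ≤ max (γint ω) (γext U) + ε / 2 :=
    max_le (hη.le.trans (by linarith [le_max_left (γint ω) (γext U)]))
      (by linarith [le_max_right (γint ω) (γext U)])
  linarith

end Gain

/-! ### Carathéodory solutions and continuation -/

/-- Global Carathéodory solutions for bounded, globally Lipschitz right-hand sides. -/
theorem exists_integral_solution {X : Type*} [NormedAddCommGroup X] [NormedSpace ℝ X]
    [CompleteSpace X] {G : ℝ → X → X} {K : ℝ≥0} {M : ℝ} (hK : ∀ t, LipschitzWith K (G t))
    (hM : ∀ t x, ‖G t x‖ ≤ M)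
    (hmeas : ∀ x : ℝ → X, Continuous x → AEStronglyMeasurable (fun s => G s (x s)) volume)
    (x₀ : X) :
    ∃ x : ℝ → X, Continuous x ∧ (∀ a b, IntervalIntegrable (fun s => G s (x s)) volume a b) ∧
      ∀ t, 0 ≤ t → x t = x₀ + ∫ s in (0 : ℝ)..t, G s (x s) := by
  have hint : ∀ x : ℝ → X, Continuous x → ∀ a b, IntervalIntegrable (fun s => G s (x s)) volume a b :=
    fun x hx a b => (intervalIntegrable_const (c := M)).mono_fun (hmeas x hx).restrict
      (Eventually.of_forall fun s => by
        simpa using (hM s (x s)).trans (le_abs_self M))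
  have hM0 : 0 ≤ M := (norm_nonneg _).trans (hM 0 0)
  -- Weighted norm: the unknown is `z s = exp (-L s) (x s - x₀)`, for which the integral operator
  -- has Lipschitz constant `K / L ≤ 1 / 2`.
  set L : ℝ := 2 * K + 1 with hL
  have hL0 : 0 < L := by positivity
  let lift : BoundedContinuousFunction ℝ X → ℝ → X := fun z s => x₀ + Real.exp (L * s) • z s
  have hlift : ∀ z, Continuous (lift z) := fun z => by
    have := z.continuous
    fun_prop
  -- `max t 0` continues the operator constantly to negative times, which keeps it bounded on all of
  -- `ℝ`.
  let P : BoundedContinuousFunction ℝ X → ℝ → X := fun z t =>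
    Real.exp (-L * max t 0) • ∫ s in (0 : ℝ)..max t 0, G s (lift z s)
  have hPc : ∀ z, Continuous (P z) := fun z => by
    have h1 : Continuous fun t : ℝ => ∫ s in (0 : ℝ)..t, G s (lift z s) :=
      intervalIntegral.continuous_primitive (fun a b => hint _ (hlift z) a b) 0
    have h2 : Continuous fun t : ℝ => max t 0 := continuous_id.max continuous_const
    exact (Real.continuous_exp.comp (continuous_const.mul h2)).smul (h1.comp h2)
  have hPb : ∀ z t, ‖P z t‖ ≤ M / L := by
    intro z t
    have ht : (0 : ℝ) ≤ max t 0 := le_max_right _ _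
    have h1 := intervalIntegral.norm_integral_le_of_norm_le_const
      (f := fun s => G s (lift z s)) (a := 0) (b := max t 0) (C := M) fun s _ => hM _ _
    rw [sub_zero, abs_of_nonneg ht] at h1
    have h2 : L * max t 0 ≤ Real.exp (L * max t 0) := by
      linarith [Real.add_one_le_exp (L * max t 0)]
    rw [norm_smul, Real.norm_eq_abs, Real.abs_exp, le_div_iff₀ hL0, neg_mul, Real.exp_neg]
    calc (Real.exp (L * max t 0))⁻¹ * ‖∫ s in (0 : ℝ)..max t 0, G s (lift z s)‖ * L
        ≤ (Real.exp (L * max t 0))⁻¹ * (M * max t 0) * L := by gcongr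
      _ = M * ((Real.exp (L * max t 0))⁻¹ * (L * max t 0)) := by ring
      _ ≤ M * ((Real.exp (L * max t 0))⁻¹ * Real.exp (L * max t 0)) := by gcongr
      _ = M := by rw [inv_mul_cancel₀ (Real.exp_pos _).ne', mul_one]
  let Φ : BoundedContinuousFunction ℝ X → BoundedContinuousFunction ℝ X := fun z =>
    BoundedContinuousFunction.ofNormedAddCommGroup (P z) (hPc z) (M / L) (hPb z)
  have hΦ : ContractingWith (1 / 2) Φ := by
    refine ⟨by rw [← NNReal.coe_lt_coe]; norm_num, LipschitzWith.of_dist_le_mul fun z z' => ?_⟩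
    refine (BoundedContinuousFunction.dist_le (by positivity)).2 fun t => ?_
    change dist (P z t) (P z' t) ≤ _
    set τ := max t 0
    have hτ : 0 ≤ τ := le_max_right _ _
    have h1 : ‖∫ s in (0 : ℝ)..τ, (G s (lift z s) - G s (lift z' s))‖ ≤
        ∫ s in (0 : ℝ)..τ, K * dist z z' * Real.exp (L * s) := by
      refine intervalIntegral.norm_integral_le_of_norm_le hτ (Eventually.of_forall fun s _ => ?_)
        (Continuous.intervalIntegrable (by fun_prop) _ _)
      rw [← dist_eq_norm]
      refine ((hK s).dist_le_mul _ _).trans ?_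
      rw [mul_assoc]
      gcongr
      simp only [lift]
      rw [dist_add_left, dist_smul₀, Real.norm_eq_abs, Real.abs_exp, mul_comm]
      gcongr
      exact BoundedContinuousFunction.dist_coe_le_dist s
    have h2 : ∫ s in (0 : ℝ)..τ, K * dist z z' * Real.exp (L * s) ≤
        K * dist z z' * (Real.exp (L * τ) / L) := by
      rw [intervalIntegral.integral_const_mul, 
        intervalIntegral.integral_comp_mul_left (fun s => Real.exp s) hL0.ne', integral_exp,
        smul_eq_mul, inv_mul_eq_div]
      gcongr
      exact sub_le_self _ (Real.exp_pos _).le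
    rw [dist_eq_norm, ← smul_sub, ← intervalIntegral.integral_sub (hint _ (hlift z) _ _)
      (hint _ (hlift z') _ _), norm_smul, Real.norm_eq_abs, Real.abs_exp, neg_mul, Real.exp_neg]
    calc (Real.exp (L * τ))⁻¹ * ‖∫ s in (0 : ℝ)..τ, (G s (lift z s) - G s (lift z' s))‖
        ≤ (Real.exp (L * τ))⁻¹ * (K * dist z z' * (Real.exp (L * τ) / L)) := by
          gcongr; exact h1.trans h2
      _ = K / L * dist z z' := by field_simp
      _ ≤ ((1 / 2 : ℝ≥0) : ℝ) * dist z z' := by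
          gcongr
          rw [div_le_iff₀ hL0]
          push_cast
          linarith
  have hfix := hΦ.fixedPoint_isFixedPt
  set z := hΦ.fixedPoint Φ
  refine ⟨lift z, hlift z, hint _ (hlift z), fun t ht => ?_⟩
  have h1 : z t = P z t := by
    conv_lhs => rw [← hfix.eq]
    rfl
  simp only [P, max_eq_left ht] at h1
  change x₀ + Real.exp (L * t) • z t = _
  rw [h1, smul_smul, ← Real.exp_add]
  simp

/-- Carathéodory solutions on the compact interval `[0,T]`. -/
def IsSolutionOn {X Y : Type*} [NormedAddCommGroup X] [NormedSpace ℝ X] (F : X → Y → X)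
    (u : ℝ → Y) (x₀ : X) (x : ℝ → X) (T : ℝ) : Prop :=
  ∀ t ∈ Icc 0 T, IntervalIntegrable (fun s => F (x s) (u s)) volume 0 t ∧
    x t = x₀ + ∫ s in (0 : ℝ)..t, F (x s) (u s)

section Regularity

variable {X Y : Type*} [NormedAddCommGroup X] [NormedSpace ℝ X] {F : X → Y → X} {u : ℝ → Y}
  {x₀ : X} {x : ℝ → X} {T U : ℝ}

theorem IsSolutionOn.continuousOn (hx : IsSolutionOn F u x₀ x T) : ContinuousOn x (Icc 0 T) := by
  rcases lt_or_ge T 0 with hT | hT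
  · rw [Icc_eq_empty hT.not_ge]; exact continuousOn_empty x
  have h1 := intervalIntegral.continuousOn_primitive_interval' (hx T ⟨hT, le_rfl⟩).1
    (left_mem_uIcc)
  rw [uIcc_of_le hT] at h1
  exact (h1.const_add x₀).congr fun t ht => (hx t ht).2

theorem IsSolutionOn.exists_lipschitzOnWith [NormedAddCommGroup Y] [ProperSpace Y]
    (hx : IsSolutionOn F u x₀ x T)
    (hF : Continuous fun p : X × Y => F p.1 p.2) (hU : ∀ᵐ t, 0 ≤ t → ‖u t‖ ≤ U) :
    ∃ C : ℝ≥0, LipschitzOnWith C x (Icc 0 T) := by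
  have hK : IsCompact ((x '' Icc 0 T) ×ˢ Metric.closedBall (0 : Y) U) :=
    (isCompact_Icc.image_of_continuousOn hx.continuousOn).prod (isCompact_closedBall 0 U)
  obtain ⟨C, hC⟩ := hK.exists_bound_of_continuousOn hF.continuousOn
  refine ⟨C.toNNReal, LipschitzOnWith.of_dist_le_mul fun s hs t ht => ?_⟩
  rw [(hx s hs).2, (hx t ht).2, dist_add_left, dist_eq_norm,
    intervalIntegral.integral_interval_sub_left (hx s hs).1 (hx t ht).1, Real.dist_eq]
  refine intervalIntegral.norm_integral_le_of_norm_le_const_ae ?_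
  filter_upwards [hU] with τ hτ hmem
  have hτ' : τ ∈ Icc 0 T := (uIoc_subset_uIcc.trans (uIcc_subset_Icc ht hs)) hmem
  exact (hC (x τ, u τ) ⟨mem_image_of_mem x hτ', by simpa using hτ hτ'.1⟩).trans
    (Real.le_coe_toNNReal C)

theorem IsSolutionOn.ae_hasDerivAt [CompleteSpace X] (hx : IsSolutionOn F u x₀ x T) :
    ∀ᵐ t, t ∈ Ioo 0 T → HasDerivAt x (F (x t) (u t)) t := by
  rcases lt_or_ge T 0 with hT | hT
  · exact Eventually.of_forall fun t ht => absurd (ht.1.trans ht.2) hT.not_gt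
  filter_upwards [(hx T ⟨hT, le_rfl⟩).1.ae_hasDerivAt_integral] with t h ht
  rw [uIcc_of_le hT] at h
  have h1 := (h (Ioo_subset_Icc_self ht) 0 (left_mem_Icc.2 hT)).const_add x₀
  refine h1.congr_of_eventuallyEq ?_
  filter_upwards [Icc_mem_nhds ht.1 ht.2] with s hs using (hx s hs).2

end Regularity

/-- A right-hand side of class `C¹` can be cut off outside a ball; the resulting global curve is a
solution as long as it stays in the ball. -/
theorem exists_curve_isSolutionOn {X Y : Type*} [NormedAddCommGroup X] [NormedSpace ℝ X]
    [FiniteDimensional ℝ X] [NormedAddCommGroup Y] [NormedSpace ℝ Y] [FiniteDimensional ℝ Y]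
    {F : X → Y → X} (hF : ContDiff ℝ 1 fun p : X × Y => F p.1 p.2) {u : ℝ → Y} {U : ℝ}
    (hu : AEStronglyMeasurable u (volume.restrict (Ici 0))) (hU : ∀ᵐ t, 0 ≤ t → ‖u t‖ ≤ U)
    (x₀ : X) (R : ℝ) :
    ∃ x : ℝ → X, Continuous x ∧ x 0 = x₀ ∧
      ∀ T, (∀ t ∈ Icc 0 T, ‖x t‖ ≤ R) → IsSolutionOn F u x₀ x T := by
  have : CompleteSpace X := FiniteDimensional.complete ℝ X
  -- The norm on `X × Y` is the maximum, so the bump equals `1` whenever `‖x‖ ≤ R` and `‖u‖ ≤ U`;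
  -- the `1` only makes the radius positive.
  let χ : ContDiffBump (0 : X × Y) := ⟨max 1 (max R U), max 1 (max R U) + 1, by positivity, by linarith⟩
  let G : X × Y → X := fun p => χ p • F p.1 p.2
  have hGd : ContDiff ℝ 1 G := χ.contDiff.smul hF
  have hGs : HasCompactSupport G := χ.hasCompactSupport.smul_right
  obtain ⟨K, hK⟩ := hGd.lipschitzWith_of_hasCompactSupport hGs one_ne_zero
  obtain ⟨M, hM⟩ := hGs.exists_bound_of_continuous hGd.continuous
  have hv : AEStronglyMeasurable ((Ici (0 : ℝ)).indicator u) volume :=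
    (aestronglyMeasurable_indicator_iff measurableSet_Ici).2 hu
  obtain ⟨x, hx, hint, hsol⟩ := exists_integral_solution
    (G := fun s y => G (y, (Ici (0 : ℝ)).indicator u s)) (K := K) (M := M)
    (fun t => by
      have := hK.comp (LipschitzWith.prodMk_right ((Ici (0 : ℝ)).indicator u t))
      rwa [mul_one] at this)
    (fun t y => hM _)
    (fun y hy => hGd.continuous.comp_aestronglyMeasurable (hy.aestronglyMeasurable.prodMk hv)) x₀
  refine ⟨x, hx, by simpa using hsol 0 le_rfl, fun T hR t ht => ?_⟩
  have hae : ∀ᵐ s, s ∈ Set.uIoc 0 t → G (x s, (Ici (0 : ℝ)).indicator u s) = F (x s) (u s) := by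
    filter_upwards [hU] with s hs hmem
    rw [uIoc_of_le ht.1] at hmem
    have hmem' : s ∈ Ici (0 : ℝ) := hmem.1.le
    rw [indicator_of_mem hmem']
    have : χ (x s, u s) = 1 := by
      refine χ.one_of_mem_closedBall ?_
      rw [mem_closedBall_zero_iff, Prod.norm_def]
      exact (max_le_max (hR s ⟨hmem.1.le, hmem.2.trans ht.2⟩) (hs hmem')).trans (le_max_right _ _)
    simp [G, this]
  refine ⟨(hint 0 t).congr_ae ?_, ?_⟩
  · exact (ae_restrict_iff' measurableSet_uIoc).2 hae
  · rw [hsol t ht.1, intervalIntegral.integral_congr_ae hae]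

/-- If `φ` exceeded `q`, it would reach some level strictly between `q` and `q'` for a first time;
up to then it is below `q'`, so the hypothesis puts it back at most at `q`. -/
theorem forall_le_of_continuation {φ : ℝ → ℝ} {q q' : ℝ} (hφ : ContinuousOn φ (Ici 0))
    (h0 : φ 0 ≤ q) (hq : q < q')
    (h : ∀ T, 0 ≤ T → (∀ t ∈ Icc 0 T, φ t < q') → φ T ≤ q) {t : ℝ} (ht : 0 ≤ t) : φ t ≤ q := by
  by_contra! hcon
  obtain ⟨m, hm1, hm2⟩ := exists_between (lt_min hcon hq)
  have hc : ∀ b, ContinuousOn φ (Icc 0 b) := fun b => hφ.mono Icc_subset_Ici_self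
  have hS : IsCompact (Icc 0 t ∩ φ ⁻¹' Ici m) := isCompact_Icc.of_isClosed_subset
    ((hc t).preimage_isClosed_of_isClosed isClosed_Icc isClosed_Ici) inter_subset_left
  obtain ⟨τ, ⟨hτ, hτm⟩, hleast⟩ := hS.exists_isLeast
    ⟨t, right_mem_Icc.2 ht, hm2.le.trans (min_le_left _ _)⟩
  have hmq : m < q' := hm2.trans_le (min_le_right _ _)
  obtain ⟨s, hs, hsm⟩ := intermediate_value_Icc hτ.1 (hc τ) ⟨h0.trans hm1.le, hτm⟩
  have hsτ : s = τ := le_antisymm hs.2 (hleast ⟨⟨hs.1, hs.2.trans hτ.2⟩, hsm.ge⟩)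
  subst hsτ
  have := h s hτ.1 fun r hr => by
    rcases hr.2.eq_or_lt with rfl | hlt
    · rwa [hsm]
    · by_contra! hge
      exact absurd (hleast ⟨⟨hr.1, hr.2.trans hτ.2⟩, hmq.le.trans hge⟩) (not_le.2 hlt)
  linarith

/-! ### Construction of radii of class `K∞` -/

theorem IsKInfty.add {γ γ' : ℝ → ℝ} (h : IsKInfty γ) (h' : IsKInfty γ') :
    IsKInfty fun r => γ r + γ' r where
  continuousOn := h.continuousOn.add h'.continuousOn
  strictMonoOn := fun _ ha _ hb hab => add_lt_add (h.strictMonoOn ha hb hab) (h'.strictMonoOn ha hb hab)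
  map_zero := by simp [h.map_zero, h'.map_zero]
  tendsto_atTop := h.tendsto_atTop.atTop_add_atTop h'.tendsto_atTop

theorem isKInfty_id : IsKInfty fun r : ℝ => r where
  continuousOn := continuousOn_id
  strictMonoOn := strictMono_id.strictMonoOn _
  map_zero := rfl
  tendsto_atTop := tendsto_id

theorem isKInfty_add_sum {ι : Type*} (s : Finset ι) {G : ι → ℝ → ℝ}
    (hG : ∀ k ∈ s, IsKInfty (G k)) : IsKInfty fun r => r + ∑ k ∈ s, G k r := by
  classical
  induction s using Finset.induction_on with
  | empty => simpa using isKInfty_id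
  | insert k s hk ih =>
    have := (hG k (Finset.mem_insert_self _ _)).add
      (ih fun j hj => hG j (Finset.mem_insert_of_mem hj))
    convert this using 2 with r
    rw [Finset.sum_insert hk]
    ring

/-- A monotone function tending to `0` at `0` is bounded by a function of class `K∞`. -/
theorem exists_isKInfty_ge {ρ : ℝ → ℝ} (hρ : Monotone ρ) (hneg : ∀ r ≤ 0, ρ r = 0)
    (hlim : Tendsto ρ (𝓝[>] 0) (𝓝 0)) : ∃ γ, IsKInfty γ ∧ ∀ r, 0 ≤ r → ρ r ≤ γ r := by
  have hint : ∀ a b, IntervalIntegrable ρ volume a b := fun a b => hρ.intervalIntegrable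
  have hmono : ∀ {r}, 0 ≤ r → Monotone fun s => ρ (r * s) := fun hr s t hst =>
    hρ (mul_le_mul_of_nonneg_left hst hr)
  have hint' : ∀ {r}, 0 ≤ r → IntervalIntegrable (fun s => ρ (r * s)) volume 1 2 := fun hr =>
    (hmono hr).intervalIntegrable
  -- The average of `ρ` over `[r, 2r]` lies between `ρ r` and `ρ (2 r)` and is continuous; adding
  -- `r` makes it strictly increasing and unbounded.
  let I : ℝ → ℝ := fun r => ∫ s in (1 : ℝ)..2, ρ (r * s)
  have hlow : ∀ r, 0 ≤ r → ρ r ≤ I r := fun r hr => by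
    have := intervalIntegral.integral_mono_on (μ := volume) one_le_two
      (intervalIntegrable_const (c := ρ r)) (hint' hr)
      fun s hs => hρ (le_mul_of_one_le_right hr hs.1)
    simpa [I, show (2 : ℝ) - 1 = 1 by norm_num] using this
  have hupp : ∀ r, 0 ≤ r → I r ≤ ρ (2 * r) := fun r hr => by
    have := intervalIntegral.integral_mono_on (μ := volume) one_le_two
      (hint' hr) (intervalIntegrable_const (c := ρ (2 * r)))
      fun s hs => hρ (by nlinarith [hs.2])
    simpa [I, show (2 : ℝ) - 1 = 1 by norm_num] using this
  have hImono : ∀ r t, 0 ≤ r → r ≤ t → I r ≤ I t := fun r t hr hrt =>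
    intervalIntegral.integral_mono_on one_le_two (hint' hr) (hint' (hr.trans hrt))
      fun s hs => hρ (mul_le_mul_of_nonneg_right hrt (zero_le_one.trans hs.1))
  have hI0 : I 0 = 0 := by simp [I, hneg 0 le_rfl]
  have hρ0 : ∀ r, 0 ≤ ρ r := fun r => by
    rcases le_total r 0 with h | h
    · rw [hneg r h]
    · rw [← hneg 0 le_rfl]; exact hρ h
  have hIc : ContinuousOn I (Ici 0) := by
    intro r hr
    rcases (mem_Ici.1 hr).eq_or_lt with rfl | hpos
    · have h2 : Tendsto (fun r : ℝ => ρ (2 * r)) (𝓝[≥] 0) (𝓝 0) := by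
        have h3 : Tendsto ρ (𝓝[≥] 0) (𝓝 0) := by
          rw [← Ioi_insert, nhdsWithin_insert]
          exact (tendsto_pure_nhds ρ 0 |>.mono_right (by rw [hneg 0 le_rfl])).sup hlim
        refine h3.comp (tendsto_nhdsWithin_iff.2 ⟨?_, ?_⟩)
        · have : Tendsto (fun r : ℝ => 2 * r) (𝓝 0) (𝓝 (2 * 0)) := tendsto_id.const_mul 2
          rw [mul_zero] at this
          exact this.mono_left nhdsWithin_le_nhds
        · filter_upwards [self_mem_nhdsWithin] with s hs
          exact mul_nonneg zero_le_two (mem_Ici.1 hs)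
      rw [ContinuousWithinAt, hI0]
      refine tendsto_of_tendsto_of_tendsto_of_le_of_le' tendsto_const_nhds h2 ?_ ?_
      · filter_upwards [self_mem_nhdsWithin] with s hs using (hρ0 s).trans (hlow s hs)
      · filter_upwards [self_mem_nhdsWithin] with s hs using hupp s hs
    · refine ContinuousAt.continuousWithinAt ?_
      have hΦ : Continuous fun b : ℝ => ∫ s in (0 : ℝ)..b, ρ s :=
        intervalIntegral.continuous_primitive hint 0
      have h1 : ContinuousAt (fun r : ℝ =>
          r⁻¹ * ((∫ s in (0 : ℝ)..(r * 2), ρ s) - ∫ s in (0 : ℝ)..(r * 1), ρ s)) r :=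
        (continuousAt_inv₀ hpos.ne').mul
          ((hΦ.comp (continuous_id.mul continuous_const)).sub
            (hΦ.comp (continuous_id.mul continuous_const))).continuousAt
      refine h1.congr ?_
      filter_upwards [lt_mem_nhds hpos] with t ht
      rw [intervalIntegral.integral_interval_sub_left (hint _ _) (hint _ _)]
      exact (intervalIntegral.integral_comp_mul_left ρ ht.ne').symm
  refine ⟨fun r => r + I r, ⟨continuousOn_id.add hIc, ?_, by simp [hI0], ?_⟩, fun r hr =>
    (hlow r hr).trans (by linarith)⟩
  · intro r hr t ht hrt
    exact add_lt_add_of_lt_of_le hrt (hImono r t hr hrt.le)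
  · refine tendsto_atTop_mono' _ ?_ tendsto_id
    filter_upwards [eventually_ge_atTop 0] with r hr
    have := (hρ0 r).trans (hlow r hr)
    simp only [id]; linarith

theorem mem_cthickening_iff_infDist_le {X : Type*} [PseudoMetricSpace X] {A : Set X}
    (hA : A.Nonempty) {δ : ℝ} (hδ : 0 ≤ δ) {y : X} :
    y ∈ Metric.cthickening δ A ↔ Metric.infDist y A ≤ δ := by
  rw [Metric.mem_cthickening_iff, Metric.infDist,
    ENNReal.le_ofReal_iff_toReal_le (Metric.infEDist_ne_top hA) hδ]

/-- An increasing family of bounded sets that shrinks into every neighbourhood of `A` as the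
parameter tends to `0` is contained in neighbourhoods of `A` with radii of class `K∞`. -/
theorem exists_isKInfty_subset_cthickening {X : Type*} [PseudoMetricSpace X] {S : ℝ → Set X}
    {A : Set X} (hA : A.Nonempty) (hne : ∀ r, 0 ≤ r → (S r).Nonempty)
    (hmono : ∀ r t, 0 ≤ r → r ≤ t → S r ⊆ S t)
    (hbdd : ∀ r, 0 ≤ r → Bornology.IsBounded (S r))
    (hsmall : ∀ ε > 0, ∃ η > 0, S η ⊆ Metric.cthickening ε A) :
    ∃ γ, IsKInfty γ ∧ ∀ r, 0 ≤ r → S r ⊆ Metric.cthickening (γ r) A := by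
  -- The largest distance from a point of `S r` to `A`, hence the smallest admissible radius.
  let σ : ℝ → ℝ := fun r => sSup ((fun y => Metric.infDist y A) '' S r)
  have hbddAbove : ∀ r, 0 ≤ r → BddAbove ((fun y => Metric.infDist y A) '' S r) := by
    intro r hr
    obtain ⟨a, ha⟩ := hA
    obtain ⟨R, hR⟩ := (hbdd r hr).subset_closedBall a
    refine ⟨R, ?_⟩
    rintro _ ⟨y, hy, rfl⟩
    exact (Metric.infDist_le_dist_of_mem ha).trans (hR hy)
  have hle : ∀ r, 0 ≤ r → ∀ y ∈ S r, Metric.infDist y A ≤ σ r := fun r hr y hy =>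
    le_csSup (hbddAbove r hr) (mem_image_of_mem _ hy)
  have hσ0 : ∀ r, 0 ≤ r → 0 ≤ σ r := fun r hr => by
    obtain ⟨y, hy⟩ := hne r hr
    exact Metric.infDist_nonneg.trans (hle r hr y hy)
  have hσm : ∀ r t, 0 ≤ r → r ≤ t → σ r ≤ σ t := fun r t hr hrt =>
    csSup_le_csSup (hbddAbove t (hr.trans hrt)) ((hne r hr).image _)
      (image_mono (hmono r t hr hrt))
  have hσs : ∀ ε > 0, ∃ η > 0, σ η ≤ ε := fun ε hε => by
    obtain ⟨η, hη, hsub⟩ := hsmall ε hε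
    refine ⟨η, hη, csSup_le ((hne η hη.le).image _) ?_⟩
    rintro _ ⟨y, hy, rfl⟩
    exact (mem_cthickening_iff_infDist_le hA hε.le).1 (hsub hy)
  have hσz : σ 0 = 0 := le_antisymm (le_of_forall_pos_le_add fun ε hε => by
    obtain ⟨η, hη, h⟩ := hσs ε hε
    linarith [hσm 0 η le_rfl hη.le]) (hσ0 0 le_rfl)
  obtain ⟨γ, hγ, hγσ⟩ := exists_isKInfty_ge (ρ := fun r => σ (max r 0))
    (fun r t hrt => hσm _ _ (le_max_right _ _) (max_le_max hrt le_rfl))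
    (fun r hr => by rw [max_eq_right hr, hσz]) (by
      rw [Metric.tendsto_nhds]
      intro ε hε
      obtain ⟨η, hη, h⟩ := hσs (ε / 2) (half_pos hε)
      filter_upwards [Ioo_mem_nhdsGT hη] with r hr
      rw [max_eq_left hr.1.le, Real.dist_eq, sub_zero, abs_of_nonneg (hσ0 r hr.1.le)]
      linarith [hσm r η hr.1.le hr.2.le])
  refine ⟨γ, hγ, fun r hr y hy => (mem_cthickening_iff_infDist_le hA (hγ.nonneg hr)).2 ?_⟩
  have := hγσ r hr
  rw [max_eq_left hr] at this
  exact (hle r hr y hy).trans this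

/-! ### Products of sublevel sets -/

section Box

variable {n₁ n₂ : ℕ}

/-- The product of two sublevel sets. -/
def box (V₁ : E n₁ → ℝ) (V₂ : E n₂ → ℝ) (c d : ℝ) : Set (Pair n₁ n₂) :=
  {y | V₁ y.fst ≤ c ∧ V₂ y.snd ≤ d}

variable {V₁ : E n₁ → ℝ} {V₂ : E n₂ → ℝ} {c d : ℝ}

theorem box_mono {c' d' : ℝ} (hc : c ≤ c') (hd : d ≤ d') : box V₁ V₂ c d ⊆ box V₁ V₂ c' d' :=
  fun _ hy => ⟨hy.1.trans hc, hy.2.trans hd⟩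

theorem zero_mem_box (h₁ : IsStorage V₁) (h₂ : IsStorage V₂) (hc : 0 ≤ c) (hd : 0 ≤ d) :
    (0 : Pair n₁ n₂) ∈ box V₁ V₂ c d := by
  simp [box, h₁.map_zero, h₂.map_zero, hc, hd]

theorem isBounded_box (h₁ : IsStorage V₁) (h₂ : IsStorage V₂) :
    Bornology.IsBounded (box V₁ V₂ c d) := by
  obtain ⟨a₁, _, ha₁, -, hb₁⟩ := h₁.bounds
  obtain ⟨a₂, _, ha₂, -, hb₂⟩ := h₂.bounds
  obtain ⟨R₁, hR₁⟩ := eventually_atTop.1 (ha₁.tendsto_atTop.eventually_gt_atTop c)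
  obtain ⟨R₂, hR₂⟩ := eventually_atTop.1 (ha₂.tendsto_atTop.eventually_gt_atTop d)
  refine isBounded_iff_forall_norm_le.2 ⟨R₁ + R₂, fun y hy => ?_⟩
  have e₁ : ‖y.fst‖ ≤ R₁ := by
    by_contra! hlt
    linarith [hR₁ _ hlt.le, (hb₁ y.fst).1, hy.1]
  have e₂ : ‖y.snd‖ ≤ R₂ := by
    by_contra! hlt
    linarith [hR₂ _ hlt.le, (hb₂ y.snd).1, hy.2]
  rw [WithLp.prod_norm_eq_of_L2]
  refine Real.sqrt_le_iff.2 ⟨by linarith [norm_nonneg y.fst, norm_nonneg y.snd], ?_⟩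
  nlinarith [norm_nonneg y.fst, norm_nonneg y.snd]

theorem IsStorage.continuous_comp_fst (h₁ : IsStorage V₁) :
    Continuous fun y : Pair n₁ n₂ => V₁ y.fst :=
  h₁.locallyLipschitz.continuous.comp (WithLp.fstL 2 ℝ (E n₁) (E n₂)).continuous

theorem IsStorage.continuous_comp_snd (h₂ : IsStorage V₂) :
    Continuous fun y : Pair n₁ n₂ => V₂ y.snd :=
  h₂.locallyLipschitz.continuous.comp (WithLp.sndL 2 ℝ (E n₁) (E n₂)).continuous

theorem isCompact_box (h₁ : IsStorage V₁) (h₂ : IsStorage V₂) : IsCompact (box V₁ V₂ c d) :=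
  Metric.isCompact_of_isClosed_isBounded
    ((isClosed_le h₁.continuous_comp_fst continuous_const).inter
      (isClosed_le h₂.continuous_comp_snd continuous_const)) (isBounded_box h₁ h₂)

/-- On the compact part of the box enlarged by `1` that lies outside the open `ε`-thickening, the
larger excess over `c` and `d` has a positive minimum `m`. An enlargement below `m` does not reach
this part. -/
theorem exists_box_add_subset (h₁ : IsStorage V₁) (h₂ : IsStorage V₂) {ε : ℝ} (hε : 0 < ε) :
    ∃ η > 0, box V₁ V₂ (c + η) (d + η) ⊆ Metric.cthickening ε (box V₁ V₂ c d) := by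
  set Q := box V₁ V₂ (c + 1) (d + 1) \ Metric.thickening ε (box V₁ V₂ c d)
  have hQ : IsCompact Q := (isCompact_box h₁ h₂).diff Metric.isOpen_thickening
  have hφ : Continuous fun y : Pair n₁ n₂ => max (V₁ y.fst - c) (V₂ y.snd - d) :=
    (h₁.continuous_comp_fst.sub continuous_const).max (h₂.continuous_comp_snd.sub continuous_const)
  obtain ⟨m, hm, hmQ⟩ : ∃ m > 0, ∀ y ∈ Q, m ≤ max (V₁ y.fst - c) (V₂ y.snd - d) := by
    rcases Q.eq_empty_or_nonempty with h0 | h0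
    · exact ⟨1, one_pos, by simp [h0]⟩
    · obtain ⟨y, hy, hmin⟩ := hQ.exists_isMinOn h0 hφ.continuousOn
      refine ⟨_, ?_, fun z hz => hmin hz⟩
      by_contra! hle
      have := max_le_iff.1 hle
      exact hy.2 (Metric.self_subset_thickening hε _ ⟨by linarith [this.1], by linarith [this.2]⟩)
  refine ⟨min 1 (m / 2), by positivity, fun y hy => ?_⟩
  by_contra hcon
  have hyQ : y ∈ Q := ⟨box_mono (by gcongr; exact min_le_left _ _)
    (by gcongr; exact min_le_left _ _) hy, fun h => hcon (Metric.thickening_subset_cthickening _ _ h)⟩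
  have h1 : max (V₁ y.fst - c) (V₂ y.snd - d) ≤ min 1 (m / 2) :=
    max_le (by linarith [hy.1]) (by linarith [hy.2])
  linarith [hmQ y hyQ, min_le_right 1 (m / 2)]

theorem convergesToNhd_of_forall_eventually {x : ℝ → Pair n₁ n₂} {A : Set (Pair n₁ n₂)} {ρ : ℝ}
    (h₁ : IsStorage V₁) (h₂ : IsStorage V₂) (hc : 0 ≤ c) (hd : 0 ≤ d)
    (hsub : box V₁ V₂ c d ⊆ Metric.cthickening ρ A)
    (hx : ∀ ε > 0, ∀ᶠ t in atTop, V₁ (x t).fst ≤ c + ε ∧ V₂ (x t).snd ≤ d + ε) :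
    ConvergesToNhd x A ρ := by
  have hne : (box V₁ V₂ c d).Nonempty := ⟨0, zero_mem_box h₁ h₂ hc hd⟩
  rw [ConvergesToNhd, Metric.tendsto_nhds]
  intro ε hε
  obtain ⟨η, hη, hsubη⟩ := exists_box_add_subset (c := c) (d := d) h₁ h₂ (half_pos hε)
  filter_upwards [hx η hη] with t ht
  have h3 := (mem_cthickening_iff_infDist_le hne (half_pos hε).le).1 (hsubη ht)
  rw [Real.dist_eq, sub_zero, abs_of_nonneg Metric.infDist_nonneg]
  linarith [Metric.infDist_le_infDist_of_subset (x := x t) hsub hne]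

end Box

/-! ### The small-gain argument -/

/-- Two systems of class `C¹` in feedback, each with an ISS-Lyapunov function. -/
structure IsFeedback {n₁ n₂ m₁ m₂ : ℕ} (f₁ : E n₁ → E n₂ → E m₁ → E n₁)
    (f₂ : E n₁ → E n₂ → E m₂ → E n₂) (V₁ : E n₁ → ℝ) (V₂ : E n₂ → ℝ)
    (γ₁₂ γ₂₁ γ₁ γ₂ α₁ α₂ : ℝ → ℝ) : Prop where
  contDiff₁ : ContDiff ℝ 1 (fun p : E n₁ × E n₂ × E m₁ => f₁ p.1 p.2.1 p.2.2)
  contDiff₂ : ContDiff ℝ 1 (fun p : E n₁ × E n₂ × E m₂ => f₂ p.1 p.2.1 p.2.2)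
  lyap₁ : IsISSLyapunov (fun x₁ x₂ u₁ => f₁ x₁ x₂ u₁) V₁ V₂ γ₁₂ γ₁ α₁
  lyap₂ : IsISSLyapunov (fun x₂ x₁ u₂ => f₂ x₁ x₂ u₂) V₂ V₁ γ₂₁ γ₂ α₂

namespace IsFeedback

variable {n₁ n₂ m₁ m₂ : ℕ} {f₁ : E n₁ → E n₂ → E m₁ → E n₁} {f₂ : E n₁ → E n₂ → E m₂ → E n₂}
  {V₁ : E n₁ → ℝ} {V₂ : E n₂ → ℝ} {γ₁₂ γ₂₁ γ₁ γ₂ α₁ α₂ : ℝ → ℝ} {u : ℝ → Pair m₁ m₂}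
  {x₀ : Pair n₁ n₂} {x : ℝ → Pair n₁ n₂} {T U : ℝ}

theorem continuous₁ (h : IsFeedback f₁ f₂ V₁ V₂ γ₁₂ γ₂₁ γ₁ γ₂ α₁ α₂) :
    Continuous fun p : E n₁ × E n₂ × E m₁ => f₁ p.1 p.2.1 p.2.2 := h.contDiff₁.continuous

theorem continuous₂ (h : IsFeedback f₁ f₂ V₁ V₂ γ₁₂ γ₂₁ γ₁ γ₂ α₁ α₂) :
    Continuous fun p : E n₂ × E n₁ × E m₂ => f₂ p.2.1 p.1 p.2.2 :=
  h.contDiff₂.continuous.comp (f := fun p : E n₂ × E n₁ × E m₂ => (p.2.1, p.1, p.2.2))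
    (by fun_prop)

theorem contDiff (h : IsFeedback f₁ f₂ V₁ V₂ γ₁₂ γ₂₁ γ₁ γ₂ α₁ α₂) :
    ContDiff ℝ 1 fun p : Pair n₁ n₂ × Pair m₁ m₂ => interconnection f₁ f₂ p.1 p.2 := by
  have a₁ := (WithLp.fstL 2 ℝ (E n₁) (E n₂)).contDiff.comp
    (contDiff_fst (𝕜 := ℝ) (n := 1) (E := Pair n₁ n₂) (F := Pair m₁ m₂))
  have a₂ := (WithLp.sndL 2 ℝ (E n₁) (E n₂)).contDiff.comp
    (contDiff_fst (𝕜 := ℝ) (n := 1) (E := Pair n₁ n₂) (F := Pair m₁ m₂))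
  have b₁ := (WithLp.fstL 2 ℝ (E m₁) (E m₂)).contDiff.comp
    (contDiff_snd (𝕜 := ℝ) (n := 1) (E := Pair n₁ n₂) (F := Pair m₁ m₂))
  have b₂ := (WithLp.sndL 2 ℝ (E m₁) (E m₂)).contDiff.comp
    (contDiff_snd (𝕜 := ℝ) (n := 1) (E := Pair n₁ n₂) (F := Pair m₁ m₂))
  exact (WithLp.prodContinuousLinearEquiv 2 ℝ (E n₁) (E n₂)).symm.contDiff.comp
    ((h.contDiff₁.comp (a₁.prodMk (a₂.prodMk b₁))).prodMk
      (h.contDiff₂.comp (a₁.prodMk (a₂.prodMk b₂))))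

theorem isTrajectory₁ (h : IsFeedback f₁ f₂ V₁ V₂ γ₁₂ γ₂₁ γ₁ γ₂ α₁ α₂)
    (hx : IsSolutionOn (interconnection f₁ f₂) u x₀ x T) (hU : ∀ᵐ t, 0 ≤ t → ‖u t‖ ≤ U) :
    IsTrajectory (fun x₁ x₂ u₁ => f₁ x₁ x₂ u₁) (fun t => (x t).fst) (fun t => (x t).snd)
      (fun t => (u t).fst) T := by
  obtain ⟨C, hC⟩ := hx.exists_lipschitzOnWith h.contDiff.continuous hU
  refine ⟨⟨C, LipschitzOnWith.of_dist_le_mul fun s hs t ht =>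
    (WithLp.dist_fst_le _ _).trans (hC.dist_le_mul s hs t ht)⟩, ?_⟩
  filter_upwards [hx.ae_hasDerivAt] with t ht hmem
  exact (WithLp.fstL 2 ℝ (E n₁) (E n₂)).hasFDerivAt.comp_hasDerivAt t (ht hmem)

theorem isTrajectory₂ (h : IsFeedback f₁ f₂ V₁ V₂ γ₁₂ γ₂₁ γ₁ γ₂ α₁ α₂)
    (hx : IsSolutionOn (interconnection f₁ f₂) u x₀ x T) (hU : ∀ᵐ t, 0 ≤ t → ‖u t‖ ≤ U) :
    IsTrajectory (fun x₂ x₁ u₂ => f₂ x₁ x₂ u₂) (fun t => (x t).snd) (fun t => (x t).fst)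
      (fun t => (u t).snd) T := by
  obtain ⟨C, hC⟩ := hx.exists_lipschitzOnWith h.contDiff.continuous hU
  refine ⟨⟨C, LipschitzOnWith.of_dist_le_mul fun s hs t ht =>
    (WithLp.dist_snd_le _ _).trans (hC.dist_le_mul s hs t ht)⟩, ?_⟩
  filter_upwards [hx.ae_hasDerivAt] with t ht hmem
  exact (WithLp.sndL 2 ℝ (E n₁) (E n₂)).hasFDerivAt.comp_hasDerivAt t (ht hmem)

/-- A solution that stays in `{V₁ < q'}` stays in the smaller box `{V₁ ≤ q, V₂ ≤ p}`, if the
small-gain condition holds between `q` and `q'`. -/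
theorem mem_box_of_forall_lt (h : IsFeedback f₁ f₂ V₁ V₂ γ₁₂ γ₂₁ γ₁ γ₂ α₁ α₂)
    (hx : IsSolutionOn (interconnection f₁ f₂) u x₀ x T) (hU : ∀ᵐ t, 0 ≤ t → ‖u t‖ ≤ U)
    {q q' p : ℝ} (hq₁ : V₁ x₀.fst ≤ q) (hq₂ : γ₁ U ≤ q) (hp₁ : V₂ x₀.snd ≤ p) (hp₂ : γ₂ U ≤ p)
    (hpq : γ₂₁ q ≤ p) (hqp : γ₁₂ p ≤ q) (hsg : ∀ s, q < s → s < q' → γ₁₂ (γ₂₁ s) < s)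
    (hlt : ∀ t ∈ Icc 0 T, V₁ (x t).fst < q') {t : ℝ} (ht : t ∈ Icc 0 T) :
    V₁ (x t).fst ≤ q ∧ V₂ (x t).snd ≤ p := by
  have hT : 0 ≤ T := ht.1.trans ht.2
  have hx0 : x 0 = x₀ := by simpa using (hx 0 ⟨le_rfl, hT⟩).2
  have hU₁ : ∀ b, ∀ᵐ t, t ∈ Ioo 0 b → ‖(u t).fst‖ ≤ U := fun b => by
    filter_upwards [hU] with t h ht using (WithLp.norm_fst_le _ _).trans (h ht.1.le)
  have hU₂ : ∀ b, ∀ᵐ t, t ∈ Ioo 0 b → ‖(u t).snd‖ ≤ U := fun b => by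
    filter_upwards [hU] with t h ht using (WithLp.norm_snd_le _ _).trans (h ht.1.le)
  have hc : ContinuousOn (fun t => V₁ (x t).fst) (Icc 0 T) :=
    h.lyap₁.storage.continuous_comp_fst.comp_continuousOn hx.continuousOn
  -- With `S` the maximum of `V₁`, the second subsystem gives `V₂ ≤ max (γ₂₁ S) p`. Fed into the
  -- first one, this bounds `S` by the largest of `q`, `γ₁₂ (γ₂₁ S)`, `γ₁₂ p` and `γ₁ U`; the loop
  -- term is excluded if `S > q`.
  obtain ⟨τ, hτ, hmax⟩ := isCompact_Icc.exists_isMaxOn ⟨0, left_mem_Icc.2 hT⟩ hc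
  have hmax' : ∀ s ∈ Icc 0 T, V₁ (x s).fst ≤ V₁ (x τ).fst := fun s hs => hmax hs
  have hV₂ : ∀ s ∈ Icc 0 T, V₂ (x s).snd ≤ max (γ₂₁ (V₁ (x τ).fst)) p := by
    intro s hs
    refine (h.lyap₂.le_max h.continuous₂ h.lyap₁.storage (h.isTrajectory₂ hx hU) le_rfl hs.1 hs.2
      (fun r hr => hmax' r ⟨hr.1.le, hr.2.le.trans hs.2⟩) (hU₂ s)).trans ?_
    rw [hx0]
    exact max_le (hp₁.trans (le_max_right _ _))
      (max_le (le_max_left _ _) (hp₂.trans (le_max_right _ _)))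
  have hS0 : 0 ≤ V₁ (x τ).fst := h.lyap₁.storage.nonneg _
  have hp0 : 0 ≤ p := (h.lyap₂.storage.nonneg _).trans hp₁
  have hSq : V₁ (x τ).fst ≤ q := by
    by_contra! hcon
    have h1 := h.lyap₁.le_max h.continuous₁ h.lyap₂.storage (h.isTrajectory₁ hx hU) le_rfl hτ.1
      hτ.2 (fun r hr => hV₂ r ⟨hr.1.le, hr.2.le.trans hτ.2⟩) (hU₁ τ)
    rw [hx0, h.lyap₁.gain_int.map_max (h.lyap₂.gain_int.nonneg hS0) hp0] at h1
    have h2 := hsg _ hcon (hlt τ hτ)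
    rcases le_max_iff.1 h1 with h1 | h1
    · linarith
    rcases le_max_iff.1 h1 with h1 | h1
    · rcases le_max_iff.1 h1 with h1 | h1 <;> linarith
    · linarith
  exact ⟨(hmax' t ht).trans hSq, (hV₂ t ht).trans
    (max_le ((h.lyap₂.gain_int.mono hS0 hSq).trans hpq) le_rfl)⟩

/-- Solutions starting below the upper end of a small-gain interval exist globally and
are asymptotically bounded in terms of the lower end `M` of the interval and of the input. -/
theorem exists_and_asymptotic_bound (h : IsFeedback f₁ f₂ V₁ V₂ γ₁₂ γ₂₁ γ₁ γ₂ α₁ α₂)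
    (hu : AEStronglyMeasurable u (volume.restrict (Ici 0))) (hU : ∀ᵐ t, 0 ≤ t → ‖u t‖ ≤ U)
    (hU0 : 0 ≤ U) {M : ℝ} {H : WithTop ℝ} (hM : 0 ≤ M) (hMH : (M : WithTop ℝ) < H)
    (hfix : γ₁₂ (γ₂₁ M) ≤ M) (hsg : ∀ s : ℝ, M < s → (s : WithTop ℝ) < H → γ₁₂ (γ₂₁ s) < s)
    (h₁ : ((V₁ x₀.fst : ℝ) : WithTop ℝ) < H) (h₂ : ((γ₁₂ (V₂ x₀.snd) : ℝ) : WithTop ℝ) < H)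
    (h₃ : ((γ₁ U : ℝ) : WithTop ℝ) < H) (h₄ : ((γ₁₂ (γ₂ U) : ℝ) : WithTop ℝ) < H) :
    (∃ x, IsSolution (interconnection f₁ f₂) u x₀ x) ∧
      ∀ x, IsSolution (interconnection f₁ f₂) u x₀ x → ∀ ε > 0, ∀ᶠ t in atTop,
        V₁ (x t).fst ≤ max M (max (γ₁ U) (γ₁₂ (γ₂ U))) + ε ∧
        V₂ (x t).snd ≤ max (γ₂₁ (max M (max (γ₁ U) (γ₁₂ (γ₂ U))))) (γ₂ U) + ε := by
  obtain ⟨q, hMq, hq₁, hq₂, hq₃, hq₄, hqH⟩ : ∃ q : ℝ, M ≤ q ∧ V₁ x₀.fst ≤ q ∧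
      γ₁₂ (V₂ x₀.snd) ≤ q ∧ γ₁ U ≤ q ∧ γ₁₂ (γ₂ U) ≤ q ∧ (q : WithTop ℝ) < H := by
    refine ⟨max M (max (max (V₁ x₀.fst) (γ₁₂ (V₂ x₀.snd))) (max (γ₁ U) (γ₁₂ (γ₂ U)))),
      by simp, by simp, by simp, by simp, by simp, ?_⟩
    simp only [WithTop.coe_max, max_lt_iff]
    exact ⟨hMH, ⟨h₁, h₂⟩, h₃, h₄⟩
  -- The strict inequalities against `H` leave room above `q`, which the continuation argument
  -- needs.
  obtain ⟨q', hqq', hq'H⟩ : ∃ q' : ℝ, q < q' ∧ (q' : WithTop ℝ) < H := by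
    obtain ⟨b, hb, hbH⟩ := exists_between hqH
    lift b to ℝ using (ne_top_of_lt hbH)
    exact ⟨b, by exact_mod_cast hb, hbH⟩
  have hq0 : 0 ≤ q := hM.trans hMq
  have hsg' : ∀ s, q < s → s < q' → γ₁₂ (γ₂₁ s) < s := fun s hs hs' =>
    hsg s (hMq.trans_lt hs) ((WithTop.coe_lt_coe.2 hs').trans hq'H)
  have hq₅ : γ₁₂ (γ₂₁ q) ≤ q := by
    rcases hMq.eq_or_lt with rfl | hlt
    · exact hfix
    · exact (hsg q hlt hqH).le
  -- This makes the box with levels `q` and `p` consistent with both gains: `γ₂₁ q ≤ p` and `γ₁₂ p ≤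
  -- q`.
  set p := max (γ₂₁ q) (max (V₂ x₀.snd) (γ₂ U)) with hp
  have hV₂0 := h.lyap₂.storage.nonneg x₀.snd
  have hγ₂0 := h.lyap₂.gain_ext.nonneg hU0
  have hγ₂₁0 := h.lyap₂.gain_int.nonneg hq0
  have hqp : γ₁₂ p ≤ q := by
    rw [hp, h.lyap₁.gain_int.map_max hγ₂₁0 (le_max_of_le_left hV₂0),
      h.lyap₁.gain_int.map_max hV₂0 hγ₂0]
    exact max_le hq₅ (max_le hq₂ hq₄)
  have hbox : ∀ {x : ℝ → Pair n₁ n₂} {T : ℝ}, IsSolutionOn (interconnection f₁ f₂) u x₀ x T →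
      (∀ t ∈ Icc 0 T, V₁ (x t).fst < q') → ∀ t ∈ Icc 0 T,
        V₁ (x t).fst ≤ q ∧ V₂ (x t).snd ≤ p := fun hx hlt t ht =>
    h.mem_box_of_forall_lt hx hU hq₁ hq₃ (by simp [hp]) (by simp [hp]) (by simp [hp]) hqp hsg'
      hlt ht
  constructor
  -- The cutoff radius contains a strictly larger box, so the curve is a true solution until it
  -- leaves that box, and it never leaves the smaller one.
  · obtain ⟨R, hR⟩ := isBounded_iff_forall_norm_le.1
      (isBounded_box (c := q') (d := p + 1) h.lyap₁.storage h.lyap₂.storage)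
    obtain ⟨x, hxc, hx0, hx⟩ := exists_curve_isSolutionOn h.contDiff hu hU x₀ R
    have hc₁ : Continuous fun t => V₁ (x t).fst :=
      h.lyap₁.storage.continuous_comp_fst.comp hxc
    have hc₂ : Continuous fun t => V₂ (x t).snd :=
      h.lyap₂.storage.continuous_comp_snd.comp hxc
    have hall : ∀ t, 0 ≤ t → max (V₁ (x t).fst - q) (V₂ (x t).snd - p) ≤ 0 := by
      intro t ht
      refine forall_le_of_continuation (q' := min (q' - q) 1)
        (φ := fun t => max (V₁ (x t).fst - q) (V₂ (x t).snd - p))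
        ((hc₁.sub continuous_const).max (hc₂.sub continuous_const)).continuousOn ?_
        (lt_min (by linarith) one_pos) ?_ ht
      · simp only [hx0]
        exact max_le (by linarith) (by simp [hp])
      · intro T hT hlt
        have hlt' : ∀ t ∈ Icc 0 T, V₁ (x t).fst < q' ∧ V₂ (x t).snd < p + 1 := fun t ht => by
          have := hlt t ht
          simp only [max_lt_iff, lt_min_iff] at this
          constructor <;> linarith [this.1.1, this.2.2]
        have hxT := hx T fun t ht => hR _ ⟨(hlt' t ht).1.le, (hlt' t ht).2.le⟩
        obtain ⟨e₁, e₂⟩ := hbox hxT (fun t ht => (hlt' t ht).1) T ⟨hT, le_rfl⟩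
        exact max_le (by linarith) (by linarith)
    refine ⟨x, fun t ht => hx t (fun s hs => ?_) t ⟨ht, le_rfl⟩⟩
    have := max_le_iff.1 (hall s hs.1)
    exact hR _ ⟨by linarith [this.1], by linarith [this.2]⟩
  · intro x hx
    have hxT : ∀ T, IsSolutionOn (interconnection f₁ f₂) u x₀ x T := fun T t ht => hx t ht.1
    have hxc : ContinuousOn x (Ici 0) := fun t ht =>
      ((hxT (t + 1)).continuousOn t ⟨ht, by linarith⟩).mono_of_mem_nhdsWithin (by
        rw [← Ici_inter_Iic]
        exact inter_mem_nhdsWithin _ (Iic_mem_nhds (by linarith)))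
    have hx0 : x 0 = x₀ := by simpa using (hx 0 le_rfl).2
    have hle : ∀ t, 0 ≤ t → V₁ (x t).fst ≤ q := fun t ht =>
      forall_le_of_continuation (φ := fun t => V₁ (x t).fst) 
        (h.lyap₁.storage.continuous_comp_fst.comp_continuousOn hxc) (by simpa [hx0])
        hqq' (fun T hT hlt => (hbox (hxT T) hlt T ⟨hT, le_rfl⟩).1) ht
    have hU₁ : ∀ᵐ t, 0 ≤ t → ‖(u t).fst‖ ≤ U := by
      filter_upwards [hU] with t h ht using (WithLp.norm_fst_le _ _).trans (h ht)
    have hU₂ : ∀ᵐ t, 0 ≤ t → ‖(u t).snd‖ ≤ U := by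
      filter_upwards [hU] with t h ht using (WithLp.norm_snd_le _ _).trans (h ht)
    -- The infimum `a` of `S` is the upper limit of `V₁` along the solution.
    let S : Set ℝ := {s | 0 ≤ s ∧ ∀ ε > 0, ∀ᶠ t in atTop, V₁ (x t).fst ≤ s + ε}
    have hSbdd : BddBelow S := ⟨0, fun s hs => hs.1⟩
    have hqS : q ∈ S := ⟨hq0, fun ε hε => by
      filter_upwards [eventually_ge_atTop 0] with t ht using (hle t ht).trans (by linarith)⟩
    set a := sInf S
    have ha0 : 0 ≤ a := le_csInf ⟨q, hqS⟩ fun s hs => hs.1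
    have haq : a ≤ q := csInf_le hSbdd hqS
    have ha : ∀ ε > 0, ∀ᶠ t in atTop, V₁ (x t).fst ≤ a + ε := by
      intro ε hε
      obtain ⟨s, hs, hsa⟩ := exists_lt_of_csInf_lt ⟨q, hqS⟩ (show sInf S < a + ε / 2 by
        simp only [a]; linarith)
      filter_upwards [hs.2 (ε / 2) (half_pos hε)] with t ht
      linarith
    have hb := h.lyap₂.asymptotic_gain h.continuous₂ h.lyap₁.storage
      (fun T _ => h.isTrajectory₂ (hxT T) hU) ha0 ha hU0 hU₂
    have hγa := h.lyap₂.gain_int.nonneg ha0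
    have ha' := h.lyap₁.asymptotic_gain h.continuous₁ h.lyap₂.storage
      (fun T _ => h.isTrajectory₁ (hxT T) hU) (le_max_of_le_left hγa) hb hU0 hU₁
    rw [h.lyap₁.gain_int.map_max hγa hγ₂0] at ha'
    -- Both asymptotic gains in succession yield another element of `S`, so `a` is bounded by its
    -- own image around the loop; since `a ≤ q < H`, the small-gain inequality excludes the loop
    -- term for `a > M`.
    have ha1 : a ≤ max (max (γ₁₂ (γ₂₁ a)) (γ₁₂ (γ₂ U))) (γ₁ U) :=
      csInf_le hSbdd ⟨le_max_of_le_right (h.lyap₁.gain_ext.nonneg hU0), ha'⟩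
    have haM : a ≤ max M (max (γ₁ U) (γ₁₂ (γ₂ U))) := by
      rcases le_max_iff.1 ha1 with h1 | h1
      · rcases le_max_iff.1 h1 with h1 | h1
        · refine le_max_of_le_left ?_
          by_contra! hlt
          exact absurd (hsg a hlt ((WithTop.coe_le_coe.2 haq).trans_lt hqH)) (not_lt.2 h1)
        · exact h1.trans (by simp)
      · exact h1.trans (by simp)
    intro ε hε
    filter_upwards [ha ε hε, hb ε hε] with t h1 h2
    refine ⟨by linarith, h2.trans ?_⟩
    gcongr
    exact h.lyap₂.gain_int.mono ha0 haM

end IsFeedback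

/-! ### Limiting boxes and exceptional initial states -/

theorem IsInput.ae_norm_le {m₁ m₂ : ℕ} {u : ℝ → Pair m₁ m₂} (hu : IsInput u) :
    ∀ᵐ t, 0 ≤ t → ‖u t‖ ≤ inputNorm u := by
  have h := (ae_restrict_iff' measurableSet_Ici).1
    (ae_le_eLpNormEssSup (f := u) (μ := volume.restrict (Ici (0 : ℝ))))
  filter_upwards [h] with t ht h0
  have h1 := ENNReal.toReal_mono hu.2.ne ((ht h0).trans_eq eLpNorm_exponent_top.symm)
  rwa [toReal_enorm] at h1

/-- The asymptotic bound on `V₁` for inputs of norm `r`. -/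
noncomputable def asymptoticLevel (γ₁₂ γ₁ γ₂ : ℝ → ℝ) (M r : ℝ) : ℝ :=
  max M (max (γ₁ r) (γ₁₂ (γ₂ r)))

/-- The asymptotic bound on the state for inputs of norm `r`. -/
def asymptoticBox {n₁ n₂ : ℕ} (V₁ : E n₁ → ℝ) (V₂ : E n₂ → ℝ) (γ₁₂ γ₂₁ γ₁ γ₂ : ℝ → ℝ) (M r : ℝ) :
    Set (Pair n₁ n₂) :=
  box V₁ V₂ (asymptoticLevel γ₁₂ γ₁ γ₂ M r)
    (max (γ₂₁ (asymptoticLevel γ₁₂ γ₁ γ₂ M r)) (γ₂ r))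

theorem IsKInfty.comp {γ γ' : ℝ → ℝ} (h : IsKInfty γ) (h' : IsKInfty γ') :
    IsKInfty fun r => γ (γ' r) where
  continuousOn := h.continuousOn.comp h'.continuousOn fun _ hr => h'.nonneg hr
  strictMonoOn := h.strictMonoOn.comp h'.strictMonoOn fun _ hr => h'.nonneg hr
  map_zero := by simp [h.map_zero, h'.map_zero]
  tendsto_atTop := h.tendsto_atTop.comp h'.tendsto_atTop

theorem zero_mem_setA {n₁ n₂ : ℕ} {V₁ : E n₁ → ℝ} {V₂ : E n₂ → ℝ} {γ₁₂ γ₂₁ : ℝ → ℝ} {M : ℝ}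
    (h₁ : IsStorage V₁) (h₂ : IsStorage V₂) (h : IsKInfty γ₂₁) (hM : 0 ≤ M) :
    (0 : Pair n₁ n₂) ∈ setA V₁ V₂ γ₁₂ γ₂₁ M := by
  simp only [setA, sublevel, mem_ofPred_eq, WithLp.zero_fst, WithLp.zero_snd, h₁.map_zero,
    h₂.map_zero, WithTop.coe_le_coe]
  exact ⟨le_max_of_le_left hM, le_max_of_le_left (h.nonneg hM)⟩

namespace IsFeedback

variable {n₁ n₂ m₁ m₂ : ℕ} {f₁ : E n₁ → E n₂ → E m₁ → E n₁} {f₂ : E n₁ → E n₂ → E m₂ → E n₂}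
  {V₁ : E n₁ → ℝ} {V₂ : E n₂ → ℝ} {γ₁₂ γ₂₁ γ₁ γ₂ α₁ α₂ : ℝ → ℝ} {M : ℝ}

theorem asymptoticLevel_mono (h : IsFeedback f₁ f₂ V₁ V₂ γ₁₂ γ₂₁ γ₁ γ₂ α₁ α₂) {r t : ℝ} (hr : 0 ≤ r)
    (hrt : r ≤ t) : asymptoticLevel γ₁₂ γ₁ γ₂ M r ≤ asymptoticLevel γ₁₂ γ₁ γ₂ M t :=
  max_le_max le_rfl (max_le_max (h.lyap₁.gain_ext.mono hr hrt)
    (h.lyap₁.gain_int.mono (h.lyap₂.gain_ext.nonneg hr) (h.lyap₂.gain_ext.mono hr hrt)))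

theorem asymptoticBox_mono (h : IsFeedback f₁ f₂ V₁ V₂ γ₁₂ γ₂₁ γ₁ γ₂ α₁ α₂) (hM : 0 ≤ M) {r t : ℝ}
    (hr : 0 ≤ r) (hrt : r ≤ t) :
    asymptoticBox V₁ V₂ γ₁₂ γ₂₁ γ₁ γ₂ M r ⊆ asymptoticBox V₁ V₂ γ₁₂ γ₂₁ γ₁ γ₂ M t :=
  box_mono (h.asymptoticLevel_mono hr hrt) (max_le_max (h.lyap₂.gain_int.mono
    (le_max_of_le_left hM) (h.asymptoticLevel_mono hr hrt)) (h.lyap₂.gain_ext.mono hr hrt))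

/-- For small inputs the asymptotic box is close to `setA`. -/
theorem eventually_asymptoticBox_subset (h : IsFeedback f₁ f₂ V₁ V₂ γ₁₂ γ₂₁ γ₁ γ₂ α₁ α₂)
    (hM : 0 ≤ M) {ε : ℝ} (hε : 0 < ε) :
    ∀ᶠ r in 𝓝[>] 0, asymptoticBox V₁ V₂ γ₁₂ γ₂₁ γ₁ γ₂ M r ⊆
      Metric.cthickening ε (setA V₁ V₂ γ₁₂ γ₂₁ M) := by
  obtain ⟨η, hη, hsub⟩ := exists_box_add_subset (c := M) (d := γ₂₁ M) h.lyap₁.storage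
    h.lyap₂.storage hε
  -- For vanishing input the limiting levels are `M` and `γ₂₁ M`, the first entries of the maxima in
  -- `setA`.
  have hA : box V₁ V₂ M (γ₂₁ M) ⊆ setA V₁ V₂ γ₁₂ γ₂₁ M := fun y hy =>
    ⟨WithTop.coe_le_coe.2 (hy.1.trans (le_max_left _ _)),
      WithTop.coe_le_coe.2 (hy.2.trans (le_max_left _ _))⟩
  have hg₂ := h.lyap₂.gain_ext.tendsto_nhdsGT
  have hlev : Tendsto (asymptoticLevel γ₁₂ γ₁ γ₂ M) (𝓝[>] 0) (𝓝 M) := by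
    have := (tendsto_const_nhds (x := M)).max (h.lyap₁.gain_ext.tendsto_nhdsGT.max
      (h.lyap₁.gain_int.comp h.lyap₂.gain_ext).tendsto_nhdsGT)
    simp only [max_self, max_eq_left hM] at this
    exact this
  have hlev₂ : Tendsto (fun r => γ₂₁ (asymptoticLevel γ₁₂ γ₁ γ₂ M r)) (𝓝[>] 0) (𝓝 (γ₂₁ M)) :=
    (h.lyap₂.gain_int.continuousOn M hM).tendsto.comp (tendsto_nhdsWithin_iff.2
      ⟨hlev, Eventually.of_forall fun r => le_max_of_le_left hM⟩)
  have hlev₃ := hlev₂.max hg₂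
  rw [max_eq_left (h.lyap₂.gain_int.nonneg hM)] at hlev₃
  filter_upwards [hlev.eventually (gt_mem_nhds (show M < M + η by linarith)),
    hlev₃.eventually (gt_mem_nhds (show γ₂₁ M < γ₂₁ M + η by linarith))] with r h1 h2
  exact (box_mono h1.le h2.le).trans (hsub.trans (Metric.cthickening_subset_of_subset ε hA))

/-- Radii of class `K∞` such that the asymptotic box for the lower end `M`, and for inputs of norm
at least `δ` also the one for the lower end `M'`, lies in the neighbourhood of `setA`. -/
theorem exists_isKInfty_asymptoticBox (h : IsFeedback f₁ f₂ V₁ V₂ γ₁₂ γ₂₁ γ₁ γ₂ α₁ α₂)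
    (hM : 0 ≤ M) {M' δ : ℝ} (hM' : 0 ≤ M') (hδ : 0 < δ) :
    ∃ γ, IsKInfty γ ∧ ∀ r, 0 ≤ r →
      asymptoticBox V₁ V₂ γ₁₂ γ₂₁ γ₁ γ₂ M r ⊆
        Metric.cthickening (γ r) (setA V₁ V₂ γ₁₂ γ₂₁ M) ∧
      (δ ≤ r → asymptoticBox V₁ V₂ γ₁₂ γ₂₁ γ₁ γ₂ M' r ⊆
        Metric.cthickening (γ r) (setA V₁ V₂ γ₁₂ γ₂₁ M)) := by
  obtain ⟨γ, hγ, hsub⟩ := exists_isKInfty_subset_cthickening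
    (S := fun r => asymptoticBox V₁ V₂ γ₁₂ γ₂₁ γ₁ γ₂ M r ∪
      {y | δ ≤ r ∧ y ∈ asymptoticBox V₁ V₂ γ₁₂ γ₂₁ γ₁ γ₂ M' r})
    (A := setA V₁ V₂ γ₁₂ γ₂₁ M)
    ⟨0, zero_mem_setA h.lyap₁.storage h.lyap₂.storage h.lyap₂.gain_int hM⟩
    (fun r hr => ⟨0, Or.inl (zero_mem_box h.lyap₁.storage h.lyap₂.storage (le_max_of_le_left hM)
      (le_max_of_le_right (h.lyap₂.gain_ext.nonneg hr)))⟩)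
    (fun r t hr hrt => union_subset_union (h.asymptoticBox_mono hM hr hrt)
      fun y hy => ⟨hy.1.trans hrt, h.asymptoticBox_mono hM' hr hrt hy.2⟩)
    (fun r _ => (isBounded_box h.lyap₁.storage h.lyap₂.storage).union
      ((isBounded_box h.lyap₁.storage h.lyap₂.storage).subset fun y hy => hy.2))
    -- Below `δ` the second part of the union is empty, so only the box for `M` has to shrink to
    -- `setA`.
    (fun ε hε => by
      obtain ⟨η, hη, hη0, hηδ⟩ :=
        ((h.eventually_asymptoticBox_subset hM hε).and (Ioo_mem_nhdsGT hδ)).exists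
      exact ⟨η, hη0, union_subset hη fun y hy => absurd hy.1 (not_le.2 hηδ)⟩)
  exact ⟨γ, hγ, fun r hr => ⟨fun y hy => hsub r hr (Or.inl hy),
    fun hδr y hy => hsub r hr (Or.inr ⟨hδr, hy⟩)⟩⟩

/-- Almost every point of `setB` lies strictly below the upper end `H`. -/
theorem ae_lt_of_mem_setB (h : IsFeedback f₁ f₂ V₁ V₂ γ₁₂ γ₂₁ γ₁ γ₂ α₁ α₂) {H : WithTop ℝ}
    (hH : 0 < H) (hfix : H.map (γ₁₂ ∘ γ₂₁) = H) :
    ∀ᵐ x : Pair n₁ n₂, x ∈ setB V₁ V₂ γ₂₁ H →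
      ((V₁ x.fst : ℝ) : WithTop ℝ) < H ∧ ((γ₁₂ (V₂ x.snd) : ℝ) : WithTop ℝ) < H := by
  induction H using WithTop.recTopCoe with
  | top => exact Eventually.of_forall fun x _ => ⟨WithTop.coe_lt_top _, WithTop.coe_lt_top _⟩
  | coe H =>
    have hH' : 0 < H := by exact_mod_cast hH
    have hfix' : γ₁₂ (γ₂₁ H) = H := WithTop.coe_injective hfix
    have q₁ : Measure.QuasiMeasurePreserving (fun x : Pair n₁ n₂ => x.fst) volume volume :=
      Measure.quasiMeasurePreserving_fst.comp
        (WithLp.volume_preserving_ofLp (E n₁) (E n₂)).quasiMeasurePreserving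
    have q₂ : Measure.QuasiMeasurePreserving (fun x : Pair n₁ n₂ => x.snd) volume volume :=
      Measure.quasiMeasurePreserving_snd.comp
        (WithLp.volume_preserving_ofLp (E n₁) (E n₂)).quasiMeasurePreserving
    have e₁ := q₁.ae (measure_eq_zero_iff_ae_notMem.1
      (h.lyap₁.volume_level_eq_zero h.continuous₁ h.lyap₂.storage hH'))
    have e₂ := q₂.ae (measure_eq_zero_iff_ae_notMem.1
      (h.lyap₂.volume_level_eq_zero h.continuous₂ h.lyap₁.storage (h.lyap₂.gain_int.pos hH')))
    filter_upwards [e₁, e₂] with x h₁ h₂ hx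
    have b₁ : V₁ x.fst ≤ H := WithTop.coe_le_coe.1 hx.1
    have b₂ : V₂ x.snd ≤ γ₂₁ H := WithTop.coe_le_coe.1 hx.2
    refine ⟨WithTop.coe_lt_coe.2 (lt_of_le_of_ne b₁ h₁), WithTop.coe_lt_coe.2 ?_⟩
    -- As `H` is a fixed point, `V₂ < γ₂₁ H` becomes `γ₁₂ (V₂) < H`.
    have := h.lyap₁.gain_int.strictMonoOn (h.lyap₂.storage.nonneg x.snd)
      (h.lyap₂.gain_int.nonneg hH'.le) (lt_of_le_of_ne b₂ h₂)
    rwa [hfix'] at this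

theorem eventually_gain_lt (h : IsFeedback f₁ f₂ V₁ V₂ γ₁₂ γ₂₁ γ₁ γ₂ α₁ α₂) {H : WithTop ℝ}
    (hH : 0 < H) : ∀ᶠ r in 𝓝[>] (0 : ℝ),
      ((γ₁ r : ℝ) : WithTop ℝ) < H ∧ ((γ₁₂ (γ₂ r) : ℝ) : WithTop ℝ) < H := by
  induction H using WithTop.recTopCoe with
  | top => exact Eventually.of_forall fun x => ⟨WithTop.coe_lt_top _, WithTop.coe_lt_top _⟩
  | coe H =>
    have hH' : 0 < H := by exact_mod_cast hH
    filter_upwards [h.lyap₁.gain_ext.tendsto_nhdsGT.eventually (gt_mem_nhds hH'),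
      (h.lyap₁.gain_int.comp h.lyap₂.gain_ext).tendsto_nhdsGT.eventually (gt_mem_nhds hH')]
      with r h1 h2 using ⟨WithTop.coe_lt_coe.2 h1, WithTop.coe_lt_coe.2 h2⟩

/-- Solutions starting below the upper end `H` of a small-gain interval with lower end `M`
exist globally and converge to every neighbourhood containing the asymptotic box. -/
theorem exists_and_converges (h : IsFeedback f₁ f₂ V₁ V₂ γ₁₂ γ₂₁ γ₁ γ₂ α₁ α₂)
    {u : ℝ → Pair m₁ m₂} (hu : IsInput u) {H : WithTop ℝ} (hM : 0 ≤ M) (hMH : (M : WithTop ℝ) < H)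
    (hfix : γ₁₂ (γ₂₁ M) = M) (hsg : ∀ s : ℝ, M < s → (s : WithTop ℝ) < H → γ₁₂ (γ₂₁ s) < s)
    {x₀ : Pair n₁ n₂}
    (h₁ : ((V₁ x₀.fst : ℝ) : WithTop ℝ) < H ∧ ((γ₁₂ (V₂ x₀.snd) : ℝ) : WithTop ℝ) < H)
    (h₂ : ((γ₁ (inputNorm u) : ℝ) : WithTop ℝ) < H ∧
      ((γ₁₂ (γ₂ (inputNorm u)) : ℝ) : WithTop ℝ) < H)
    {A : Set (Pair n₁ n₂)} {ρ : ℝ}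
    (hA : asymptoticBox V₁ V₂ γ₁₂ γ₂₁ γ₁ γ₂ M (inputNorm u) ⊆ Metric.cthickening ρ A) :
    (∃ x, IsSolution (interconnection f₁ f₂) u x₀ x) ∧
      ∀ x, IsSolution (interconnection f₁ f₂) u x₀ x → ConvergesToNhd x A ρ := by
  have hU0 : 0 ≤ inputNorm u := ENNReal.toReal_nonneg
  obtain ⟨hex, hall⟩ := h.exists_and_asymptotic_bound hu.1 hu.ae_norm_le hU0 hM hMH hfix.le hsg
    h₁.1 h₁.2 h₂.1 h₂.2
  exact ⟨hex, fun x hx => convergesToNhd_of_forall_eventually h.lyap₁.storage h.lyap₂.storage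
    (le_max_of_le_left hM) (le_max_of_le_right (h.lyap₂.gain_ext.nonneg hU0)) hA (hall x hx)⟩

end IsFeedback

end FeedbackISS

/-! ### The main theorem -/

theorem theorem1 {n₁ n₂ m₁ m₂ : ℕ}
    (f₁ : E n₁ → E n₂ → E m₁ → E n₁) (f₂ : E n₁ → E n₂ → E m₂ → E n₂)
    (hf₁ : ContDiff ℝ 1 (fun p : E n₁ × E n₂ × E m₁ => f₁ p.1 p.2.1 p.2.2))
    (hf₂ : ContDiff ℝ 1 (fun p : E n₁ × E n₂ × E m₂ => f₂ p.1 p.2.1 p.2.2))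
    (hf₁0 : f₁ 0 0 0 = 0) (hf₂0 : f₂ 0 0 0 = 0)
    (V₁ : E n₁ → ℝ) (V₂ : E n₂ → ℝ) (γ₁₂ γ₂₁ γ₁ γ₂ α₁ α₂ : ℝ → ℝ)
    (hV₁ : IsISSLyapunov (fun x₁ x₂ u₁ => f₁ x₁ x₂ u₁) V₁ V₂ γ₁₂ γ₁ α₁)
    (hV₂ : IsISSLyapunov (fun x₂ x₁ u₂ => f₂ x₁ x₂ u₂) V₂ V₁ γ₂₁ γ₂ α₂)
    (ℓ : ℕ) (Mlo : ℕ → ℝ) (Mhi : ℕ → WithTop ℝ)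
    (hM : LocalSmallGain γ₁₂ γ₂₁ ℓ Mlo Mhi) :
    ∃ γ : ℝ → ℝ, IsKInfty γ ∧
      (Mhi ℓ = ⊤ →
        ∀ k ∈ Set.Icc 1 ℓ, ∀ u : ℝ → Pair m₁ m₂, IsInput u →
          AlmostAllConverge (interconnection f₁ f₂) u
            (setB V₁ V₂ γ₂₁ (Mhi k)) (setA V₁ V₂ γ₁₂ γ₂₁ (Mlo k)) (γ (inputNorm u))) ∧
      (Mhi ℓ ≠ ⊤ →
        ∃ δ : ℝ, 0 < δ ∧
          ∀ k ∈ Set.Icc 1 ℓ, ∀ u : ℝ → Pair m₁ m₂, IsInput u → inputNorm u ≤ δ →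
            AlmostAllConverge (interconnection f₁ f₂) u
              (setB V₁ V₂ γ₂₁ (Mhi k)) (setA V₁ V₂ γ₁₂ γ₂₁ (Mlo k)) (γ (inputNorm u))) := by
  have h : IsFeedback f₁ f₂ V₁ V₂ γ₁₂ γ₂₁ γ₁ γ₂ α₁ α₂ := ⟨hf₁, hf₂, hV₁, hV₂⟩
  have hℓ : ℓ ∈ Set.Icc 1 ℓ := ⟨hM.one_le, le_rfl⟩
  have hpos : ∀ k ∈ Set.Icc 1 ℓ, (0 : WithTop ℝ) < Mhi k := fun k hk =>
    lt_of_le_of_lt (WithTop.coe_le_coe.2 (hM.nonneg k hk)) (hM.lt k hk)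
  -- One `δ` keeps the input levels below the upper ends of all intervals.
  obtain ⟨δ, hδ, hδ0⟩ := (((Filter.eventually_all_finite (Set.finite_Icc 1 ℓ)).2 fun k hk =>
    h.eventually_gain_lt (hpos k hk)).and self_mem_nhdsWithin).exists
  have hδ0 : 0 < δ := hδ0
  have hsmall : ∀ k ∈ Set.Icc 1 ℓ, ∀ r, 0 ≤ r → r ≤ δ →
      ((γ₁ r : ℝ) : WithTop ℝ) < Mhi k ∧ ((γ₁₂ (γ₂ r) : ℝ) : WithTop ℝ) < Mhi k :=
    fun k hk r hr hrδ =>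
      ⟨(WithTop.coe_le_coe.2 (hV₁.gain_ext.mono hr hrδ)).trans_lt (hδ k hk).1,
        (WithTop.coe_le_coe.2 ((hV₁.gain_int.comp hV₂.gain_ext).mono hr hrδ)).trans_lt (hδ k hk).2⟩
  choose! G hG hGsub using fun k (hk : k ∈ Set.Icc 1 ℓ) =>
    h.exists_isKInfty_asymptoticBox (hM.nonneg k hk) (hM.nonneg ℓ hℓ) hδ0
  have hG' : ∀ k ∈ Finset.Icc 1 ℓ, IsKInfty (G k) := fun k hk => hG k (Finset.mem_Icc.1 hk)
  set γ : ℝ → ℝ := fun r => r + ∑ k ∈ Finset.Icc 1 ℓ, G k r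
  have hGγ : ∀ k ∈ Set.Icc 1 ℓ, ∀ r, 0 ≤ r → G k r ≤ γ r := fun k hk r hr => by
    have := Finset.single_le_sum (f := fun k => G k r) (fun j hj => (hG' j hj).nonneg hr)
      (Finset.mem_Icc.2 hk)
    simp only [γ]
    linarith
  have hlocal : ∀ k ∈ Set.Icc 1 ℓ, ∀ u : ℝ → Pair m₁ m₂, IsInput u → inputNorm u ≤ δ →
      AlmostAllConverge (interconnection f₁ f₂) u
        (setB V₁ V₂ γ₂₁ (Mhi k)) (setA V₁ V₂ γ₁₂ γ₂₁ (Mlo k)) (γ (inputNorm u)) := by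
    intro k hk u hu hur
    have hU0 : 0 ≤ inputNorm u := ENNReal.toReal_nonneg
    filter_upwards [h.ae_lt_of_mem_setB (hpos k hk) (hM.fixed_hi k hk)] with x₀ hx₀ hB
    exact h.exists_and_converges hu (hM.nonneg k hk) (hM.lt k hk) (hM.fixed_lo k hk)
      (hM.small_gain k hk) (hx₀ hB) (hsmall k hk _ hU0 hur)
      ((hGsub k hk _ hU0).1.trans (Metric.cthickening_mono (hGγ k hk _ hU0) _))
  refine ⟨γ, isKInfty_add_sum _ hG', fun htop k hk u hu => ?_, fun _ => ⟨δ, hδ0, hlocal⟩⟩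
  rcases le_total (inputNorm u) δ with hur | hur
  · exact hlocal k hk u hu hur
  · have hU0 : 0 ≤ inputNorm u := ENNReal.toReal_nonneg
    have hlt : ∀ s : ℝ, (s : WithTop ℝ) < Mhi ℓ := fun s => htop ▸ WithTop.coe_lt_top s
    -- For large inputs the last interval, unbounded above, serves every initial state; its limiting
    -- box lies in the neighbourhood of the `k`-th `setA` by the choice of `G k` for `r ≥ δ`.
    exact Eventually.of_forall fun x₀ _ =>
      h.exists_and_converges hu (hM.nonneg ℓ hℓ) (hM.lt ℓ hℓ) (hM.fixed_lo ℓ hℓ)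
        (hM.small_gain ℓ hℓ) ⟨hlt _, hlt _⟩ ⟨hlt _, hlt _⟩
        (((hGsub k hk _ hU0).2 hur).trans (Metric.cthickening_mono (hGγ k hk _ hU0) _))
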